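/- Let $\alpha>1$ and let $J_\alpha=(J_\alpha(r))_{r\ge 1}$ be coupling constants with $J_\alpha(r)\asymp r^{-\alpha}$, i.e. there are constants $0<a\le A<\infty$ such that $a\,r^{-\alpha}\le J_\alpha(r)\le A\,r^{-\alpha}$ for all integers $r\ge 1$. For $n\ge 1$ and $\beta>0$ let $\Lambda_n=\{-n,\dots,n\}\subset\mathbb Z$, and let the discrete Gaussian chain $\Psi_n=(\Psi_n(x))_{x\in\mathbb Z}$ at inverse temperature $\beta$ with Dirichlet boundary conditions be the random field with values in the integer-valued configurations $h:\mathbb Z\to\mathbb Z$ that vanish outside $\Lambda_n$, with law $$\mathbb P(\Psi_n=h)\;\propto\;\exp\Big(-\frac{\beta}{2}\sum_{i\neq j\in\mathbb Z}J_\alpha(|i-j|)\,(h_i-h_j)^2\Big)\,,$$ the sum being over ordered pairs. 1. If $\alpha\in(1,2)$, there exists a constant $c=c(J_\alpha)>0$ such that for every $\beta>0$, every $n\ge 1$ and every $x\in\mathbb Z$, the law above is a well-defined probability measure, $\Psi_n(x)$ is square integrable, and $$\mathrm{Var}\big(\Psi_n(x)\big)\le \frac{c}{\beta}\,.$$ 2.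 If $\alpha>3$, then for every $\beta>0$ there exist constants $0<c_1(\beta)<c_2(\beta)<\infty$ (which may depend on $J_\alpha$) such that for every $n\ge 1$ the law above is a well-defined probability measure, $\Psi_n(0)$ is square integrable, and $$c_1(\beta)\,n\;\le\;\mathrm{Var}\big(\Psi_n(0)\big)\;\le\;c_2(\beta)\,n\,.$$ -/

import Mathlib

open MeasureTheory ProbabilityTheory

noncomputable section

namespace DGChain

/-- Coupling constants with `J r ≍ r ^ (-α)` on `r ≥ 1`: the ratio is bounded above and below by
positive constants.  (The value `J 0` is never used.) -/
def IsCoupling (α : ℝ) (J : ℕ → ℝ) : Prop :=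
  ∃ a A : ℝ, 0 < a ∧ 0 < A ∧
    ∀ r : ℕ, 1 ≤ r → a * (r : ℝ) ^ (-α) ≤ J r ∧ J r ≤ A * (r : ℝ) ^ (-α)

/-- Integer-valued configurations on `ℤ` that vanish outside the interval `{-n, …, n}`. -/
def Config (n : ℕ) : Type :=
  {h : ℤ → ℤ // ∀ i : ℤ, i ∉ Set.Icc (-(n : ℤ)) (n : ℤ) → h i = 0}

/-- The Hamiltonian: the sum over all ordered pairs `i ≠ j` in `ℤ` of `J |i - j| (h i - h j) ^ 2`.
The series converges absolutely for finitely supported `h` when `J` is summable. -/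
def energy (J : ℕ → ℝ) (h : ℤ → ℤ) : ℝ :=
  ∑' p : ℤ × ℤ, if p.1 ≠ p.2 then J (p.1 - p.2).natAbs * ((h p.1 : ℝ) - (h p.2 : ℝ)) ^ 2 else 0

/-- The unnormalised Gibbs measure on fields `ℤ → ℤ`: each configuration vanishing outside
`{-n, …, n}` carries the mass `exp (-(β / 2) * energy J h)`. -/
def gibbsWeight (n : ℕ) (J : ℕ → ℝ) (β : ℝ) : Measure (ℤ → ℤ) :=
  Measure.sum fun h : Config n =>
    ENNReal.ofReal (Real.exp (-(β / 2) * energy J h.1)) • Measure.dirac h.1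

/-- The law of the discrete Gaussian chain on `{-n, …, n}` with Dirichlet boundary conditions, at
inverse temperature `β`: the Gibbs measure divided by its total mass. -/
def law (n : ℕ) (J : ℕ → ℝ) (β : ℝ) : Measure (ℤ → ℤ) :=
  (gibbsWeight n J β Set.univ)⁻¹ • gibbsWeight n J β

/-- The height of the field at the site `x`, as a real random variable. -/
def height (x : ℤ) (h : ℤ → ℤ) : ℝ := (h x : ℝ)

end DGChain

end

/-! With weights `exp (-Q / 2)`, where `Q = β * energy` is a quadratic form on a torsion-free
abelian group, everything rests on one algebraic fact. The map `(x, y) ↦ (x + y, x - y)` sends pairs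
bijectively onto pairs congruent modulo `2Γ`, so `∑ F (x + y) * G (x - y)` is a positive
semidefinite form in `F`, `G`. The parallelogram law turns a product of two weights into such an
expression.

Upper bounds. Cauchy–Schwarz for this form gives `M(X) ^ 4 ≤ M(2X)` for the normalised moment
generating function `M`; iterating against a crude bound yields Gaussian tails, so `X ^ 2 ≤ C * Q`
implies a second moment of at most `12 * C` (`IsGaussianForm.tsum_sq_le`). It remains to bound `h x
^ 2` by the energy. For `α < 2` this is uniform in `n`: averages of `h` over dyadic blocks starting
at `x` tend to `0`, and their increments decay geometrically (`IsCoupling.exists_sq_le_energy`). In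
general, telescoping along nearest neighbours costs a factor of order `n`.

Lower bound for `α > 3`. The same positivity gives a Ginibre-type inequality: adding squares of
linear functionals to `Q` decreases second moments (`Reinforces`). By the Lagrange identity,
replacing each long-range coupling by nearest-neighbour couplings along the path adds only such
squares; the resulting edge strength is finite because `∑ r ^ 2 * J r < ∞`. Infinitely strong
squares then force `h i = h (-i)`. What remains is a walk with `n + 1` independent steps, whose
endpoint `h 0` has variance proportional to `n + 1`. -/

open MeasureTheory ProbabilityTheory Filter Topology

namespace DGChain

/-! ### Positivity of the doubled pairing -/

section Doubling

variable {Γ : Type*} [AddCommGroup Γ]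

/-- The pairing `∑ F (x + y) * G (x - y)` over all pairs `(x, y)`. -/
noncomputable def pairing (F G : Γ → ℝ) : ℝ :=
  ∑' p : Γ × Γ, F (p.1 + p.2) * G (p.1 - p.2)

theorem injective_add_sub [IsAddTorsionFree Γ] :
    Function.Injective (fun p : Γ × Γ => (p.1 + p.2, p.1 - p.2)) := by
  rintro ⟨a, b⟩ ⟨c, d⟩ h
  simp only [Prod.mk.injEq] at h
  obtain ⟨h1, h2⟩ := h
  have h3 : (2 : ℕ) • a = (2 : ℕ) • c := by
    have : (a + b) + (a - b) = (c + d) + (c - d) := by rw [h1, h2]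
    rw [two_nsmul, two_nsmul]
    simpa using this
  have h4 : a = c := nsmul_right_injective two_ne_zero h3
  subst h4
  simpa using h1

theorem summable_pairing [IsAddTorsionFree Γ] {F G : Γ → ℝ} (hF : Summable F) (hG : Summable G) :
    Summable fun p : Γ × Γ => F (p.1 + p.2) * G (p.1 - p.2) := by
  have h : Summable fun p : Γ × Γ => F p.1 * G p.2 :=
    summable_mul_of_summable_norm hF.norm hG.norm
  exact Summable.comp_injective h (i := fun p : Γ × Γ => (p.1 + p.2, p.1 - p.2)) injective_add_sub

/-- The sum and difference of two elements differ by an element of `2Γ`, and conversely any two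
elements of one coset arise this way, uniquely since there is no torsion. Symmetry and positivity of
the pairing can be read off from this diagonal form. -/
theorem pairing_eq_tsum_fibers [IsAddTorsionFree Γ] {F G : Γ → ℝ} (hF : Summable F)
    (hG : Summable G) :
    pairing F G = ∑' c : Γ ⧸ (nsmulAddMonoidHom (α := Γ) 2).range,
      (∑' b : (QuotientAddGroup.mk : Γ → Γ ⧸ (nsmulAddMonoidHom (α := Γ) 2).range) ⁻¹' {c}, F b) *
      (∑' b : (QuotientAddGroup.mk : Γ → Γ ⧸ (nsmulAddMonoidHom (α := Γ) 2).range) ⁻¹' {c}, G b)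
    := by
  classical
  set q : Γ → Γ ⧸ (nsmulAddMonoidHom (α := Γ) 2).range := QuotientAddGroup.mk with hq
  set K : Γ × Γ → ℝ := fun p => if q p.2 = q p.1 then F p.1 * G p.2 else 0 with hK
  have hprod := summable_mul_of_summable_norm hF.norm hG.norm
  have hKs : Summable K := by
    refine Summable.of_norm_bounded hprod.norm fun p => ?_
    simp only [hK]
    split_ifs
    · exact le_rfl
    · rw [norm_zero]
      exact norm_nonneg _
  have h1 : pairing F G = ∑' p, K p := by
    rw [← injective_add_sub.tsum_eq (f := K)]
    · refine tsum_congr fun p => ?_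
      simp only [hK]
      rw [if_pos]
      rw [hq, QuotientAddGroup.eq]
      exact ⟨p.2, by rw [nsmulAddMonoidHom_apply, two_nsmul]; abel⟩
    · rintro ⟨s, d⟩ hp
      have hp' : q d = q s := by
        by_contra hne
        exact hp (by simp [hK, hne])
      rw [hq, QuotientAddGroup.eq] at hp'
      obtain ⟨y, hy⟩ := hp'
      refine ⟨(d + y, y), ?_⟩
      simp only [nsmulAddMonoidHom_apply, two_nsmul] at hy
      ext1
      · simp only [add_assoc, hy]
        abel
      · simp
  have h2 : ∑' p, K p = ∑' s, F s * ∑' d : q ⁻¹' {q s}, G d := by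
    rw [hKs.tsum_prod]
    refine tsum_congr fun s => ?_
    rw [tsum_subtype (q ⁻¹' {q s}) G, ← tsum_mul_left]
    refine tsum_congr fun d => ?_
    simp [hK, Set.indicator_apply]
  have h3 : Summable fun s => F s * ∑' d : q ⁻¹' {q s}, G d := by
    have := hKs.prod
    refine this.congr fun s => ?_
    rw [tsum_subtype (q ⁻¹' {q s}) G, ← tsum_mul_left]
    refine tsum_congr fun d => ?_
    simp [hK, Set.indicator_apply]
  rw [h1, h2, ← (h3.hasSum.tsum_fiberwise q).tsum_eq]
  refine tsum_congr fun c => ?_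
  rw [← tsum_mul_right]
  refine tsum_congr fun b => ?_
  obtain ⟨b, rfl⟩ := b
  rfl

theorem pairing_self_nonneg [IsAddTorsionFree Γ] {F : Γ → ℝ} (hF : Summable F) :
    0 ≤ pairing F F := by
  rw [pairing_eq_tsum_fibers hF hF]
  exact tsum_nonneg fun c => mul_self_nonneg _

theorem pairing_comm [IsAddTorsionFree Γ] {F G : Γ → ℝ} (hF : Summable F) (hG : Summable G) :
    pairing F G = pairing G F := by
  rw [pairing_eq_tsum_fibers hF hG, pairing_eq_tsum_fibers hG hF]
  exact tsum_congr fun c => mul_comm _ _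

theorem pairing_sq_le [IsAddTorsionFree Γ] {F G : Γ → ℝ} (hF : Summable F) (hG : Summable G) :
    pairing F G ^ 2 ≤ pairing F F * pairing G G := by
  have key : ∀ t : ℝ, 0 ≤ pairing G G * (t * t) + (2 * pairing F G) * t + pairing F F := by
    intro t
    have h0 := pairing_self_nonneg (hF.add (hG.mul_left t))
    have hexp : pairing (fun x => F x + t * G x) (fun x => F x + t * G x) =
        pairing F F + t * pairing F G + t * pairing G F + t * t * pairing G G := by
      have e : ∀ p : Γ × Γ, (F (p.1 + p.2) + t * G (p.1 + p.2)) *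
          (F (p.1 - p.2) + t * G (p.1 - p.2)) =
          F (p.1 + p.2) * F (p.1 - p.2) + t * (F (p.1 + p.2) * G (p.1 - p.2)) +
          t * (G (p.1 + p.2) * F (p.1 - p.2)) + t * t * (G (p.1 + p.2) * G (p.1 - p.2)) :=
        fun p => by ring
      unfold pairing
      have s1 := summable_pairing hF hF
      have s2 := (summable_pairing hF hG).mul_left t
      have s3 := (summable_pairing hG hF).mul_left t
      have s4 := (summable_pairing hG hG).mul_left (t * t)
      rw [tsum_congr e, ((s1.add s2).add s3).tsum_add s4, (s1.add s2).tsum_add s3, s1.tsum_add s2,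
        tsum_mul_left, tsum_mul_left, tsum_mul_left]
    rw [hexp, pairing_comm hG hF] at h0
    linarith
  have := discrim_le_zero key
  rw [discrim] at this
  linarith

end Doubling

/-! ### Subgaussian moment bounds for discrete Gaussian weights -/

section Gaussian

variable {Γ : Type*} [AddCommGroup Γ]

/-- A nonnegative form satisfying the parallelogram law, positive enough for the Gaussian sums
`∑ exp (-t Q)` to converge. -/
structure IsGaussianForm (Q : Γ → ℝ) : Prop where
  nonneg : ∀ x, 0 ≤ Q x
  parallelogram : ∀ x y, Q (x + y) + Q (x - y) = 2 * Q x + 2 * Q y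
  summable : ∀ t : ℝ, 0 < t → Summable fun x => Real.exp (-t * Q x)

theorem IsGaussianForm.summable_exp_add {Q : Γ → ℝ} (hQ : IsGaussianForm Q) {X : Γ → ℝ} {C : ℝ}
    (hX : ∀ x, X x ^ 2 ≤ C * Q x) {t : ℝ} (ht : 0 < t) :
    Summable fun x => Real.exp (-t * Q x + X x) := by
  wlog hC : 0 < C generalizing C
  · exact this (C := 1) (fun x => (hX x).trans
      (mul_le_mul_of_nonneg_right (by linarith) (hQ.nonneg x))) one_pos
  refine Summable.of_nonneg_of_le (fun _ => (Real.exp_pos _).le) (fun x => ?_)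
    ((hQ.summable (t / 2) (by positivity)).mul_right (Real.exp (C / (2 * t))))
  rw [← Real.exp_add]
  refine Real.exp_le_exp.2 ?_
  -- Young's inequality, weighted so that the quadratic term uses up only half of `t * Q`.
  have h1 : X x ≤ t / (2 * C) * X x ^ 2 + C / (2 * t) := by
    have : t / (2 * C) * X x ^ 2 + C / (2 * t) - X x = (t * X x - C) ^ 2 / (2 * C * t) := by
      field_simp
      ring
    have h2 : 0 ≤ (t * X x - C) ^ 2 / (2 * C * t) := by positivity
    linarith
  have h2 : t / (2 * C) * X x ^ 2 ≤ t / (2 * C) * (C * Q x) :=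
    mul_le_mul_of_nonneg_left (hX x) (by positivity)
  have h3 : t / (2 * C) * (C * Q x) = t / 2 * Q x := by field_simp
  linarith

theorem sq_div_two_le_exp_add_exp_neg (x : ℝ) : x ^ 2 / 2 ≤ Real.exp x + Real.exp (-x) := by
  wlog hx : 0 ≤ x generalizing x
  · have := this (-x) (by linarith)
    rw [neg_sq, neg_neg] at this
    linarith
  have := Real.quadratic_le_exp_of_nonneg hx
  linarith [Real.exp_pos (-x)]

theorem IsGaussianForm.summable_exp_mul_sq {Q : Γ → ℝ} (hQ : IsGaussianForm Q) {X : Γ → ℝ} {C : ℝ}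
    (hX : ∀ x, X x ^ 2 ≤ C * Q x) {t : ℝ} (ht : 0 < t) :
    Summable fun x => Real.exp (-t * Q x) * X x ^ 2 := by
  have hX' : ∀ x, (-X x) ^ 2 ≤ C * Q x := fun x => by rw [neg_sq]; exact hX x
  refine Summable.of_nonneg_of_le (fun _ => by positivity) (fun x => ?_)
    (((hQ.summable_exp_add hX ht).add (hQ.summable_exp_add hX' ht)).mul_left 2)
  rw [Real.exp_add, Real.exp_add, ← mul_add, mul_left_comm]
  refine mul_le_mul_of_nonneg_left ?_ (Real.exp_pos _).le
  linarith [sq_div_two_le_exp_add_exp_neg (X x)]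

theorem IsGaussianForm.summable_exp_mul {Q : Γ → ℝ} (hQ : IsGaussianForm Q) {X : Γ → ℝ} {C : ℝ}
    (hX : ∀ x, X x ^ 2 ≤ C * Q x) {t : ℝ} (ht : 0 < t) :
    Summable fun x => Real.exp (-t * Q x) * X x := by
  refine Summable.of_norm_bounded ((hQ.summable t ht).add (hQ.summable_exp_mul_sq hX ht))
    fun x => ?_
  rw [norm_mul, Real.norm_eq_abs, Real.abs_exp, Real.norm_eq_abs]
  have : |X x| ≤ 1 + X x ^ 2 := by nlinarith [sq_abs (X x), sq_nonneg (|X x| - 1)]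
  nlinarith [Real.exp_pos (-t * Q x)]

/-- The discrete counterpart of the rotation invariance of a pair of independent Gaussians; it is
the parallelogram law exponentiated. -/
theorem IsGaussianForm.exp_mul_exp {Q : Γ → ℝ} (hQ : IsGaussianForm Q) (x y : Γ) :
    Real.exp (-(1 / 2) * Q x) * Real.exp (-(1 / 2) * Q y) =
      Real.exp (-(1 / 4) * Q (x + y)) * Real.exp (-(1 / 4) * Q (x - y)) := by
  rw [← Real.exp_add, ← Real.exp_add]
  congr 1
  linarith [hQ.parallelogram x y]

/-- Regev and Stephens-Davidowitz: the moment generating function grows at least like that of a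
Gaussian variable under doubling. -/
theorem IsGaussianForm.mgf_pow_four_le [IsAddTorsionFree Γ] {Q : Γ → ℝ} (hQ : IsGaussianForm Q)
    (X : Γ →+ ℝ) {C : ℝ} (hX : ∀ x, X x ^ 2 ≤ C * Q x) :
    (∑' x, Real.exp (-(1 / 2) * Q x + X x)) ^ 4 ≤
      (∑' x, Real.exp (-(1 / 2) * Q x)) ^ 3 *
        ∑' x, Real.exp (-(1 / 2) * Q x + 2 * X x) := by
  have hX2 : ∀ x, (2 * X x) ^ 2 ≤ (4 * C) * Q x := fun x => by nlinarith [hX x]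
  have s0 := hQ.summable (1 / 2) (by norm_num)
  have s1 := hQ.summable_exp_add hX (t := 1 / 2) (by norm_num)
  have s2 := hQ.summable_exp_add hX2 (t := 1 / 2) (by norm_num)
  have u0 := hQ.summable (1 / 4) (by norm_num)
  have u1 := hQ.summable_exp_add hX (t := 1 / 4) (by norm_num)
  -- With `u` the weight at rate `1 / 4` and `v` the same weight tilted by `X`, the three products
  -- below are the pairings `(v, u)`, `(u, u)` and `(v, v)`, since `X x + X y = X (x + y)` and `2 *
  -- X x = X (x + y) + X (x - y)`. The claim is Cauchy–Schwarz.
  have e1 : (∑' x, Real.exp (-(1 / 2) * Q x + X x)) * (∑' x, Real.exp (-(1 / 2) * Q x + X x)) =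
      pairing (fun x => Real.exp (-(1 / 4) * Q x + X x)) (fun x => Real.exp (-(1 / 4) * Q x)) := by
    rw [tsum_mul_tsum_of_summable_norm s1.norm s1.norm, pairing]
    refine tsum_congr fun p => ?_
    simp only [Real.exp_add, map_add]
    linear_combination Real.exp (X p.1) * Real.exp (X p.2) * hQ.exp_mul_exp p.1 p.2
  have e2 : (∑' x, Real.exp (-(1 / 2) * Q x)) * (∑' x, Real.exp (-(1 / 2) * Q x)) =
      pairing (fun x => Real.exp (-(1 / 4) * Q x)) (fun x => Real.exp (-(1 / 4) * Q x)) := by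
    rw [tsum_mul_tsum_of_summable_norm s0.norm s0.norm, pairing]
    exact tsum_congr fun p => hQ.exp_mul_exp p.1 p.2
  have e3 : (∑' x, Real.exp (-(1 / 2) * Q x + 2 * X x)) * (∑' x, Real.exp (-(1 / 2) * Q x)) =
      pairing (fun x => Real.exp (-(1 / 4) * Q x + X x))
        (fun x => Real.exp (-(1 / 4) * Q x + X x)) := by
    rw [tsum_mul_tsum_of_summable_norm s2.norm s0.norm, pairing]
    refine tsum_congr fun p => ?_
    have h2 : Real.exp (2 * X p.1) = Real.exp (X (p.1 + p.2)) * Real.exp (X (p.1 - p.2)) := by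
      rw [← Real.exp_add, map_add, map_sub]
      congr 1
      ring
    simp only [Real.exp_add]
    linear_combination Real.exp (2 * X p.1) * hQ.exp_mul_exp p.1 p.2 +
      Real.exp (-(1 / 4) * Q (p.1 + p.2)) * Real.exp (-(1 / 4) * Q (p.1 - p.2)) * h2
  have := pairing_sq_le u1 u0
  rw [← e1, ← e2, ← e3] at this
  calc _ = _ := by ring
    _ ≤ _ := this
    _ = _ := by ring

theorem IsGaussianForm.tsum_pos {Q : Γ → ℝ} (hQ : IsGaussianForm Q) :
    0 < ∑' x, Real.exp (-(1 / 2) * Q x) :=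
  (hQ.summable (1 / 2) (by norm_num)).tsum_pos (fun _ => (Real.exp_pos _).le) 0 (Real.exp_pos _)

/-- Doubling `k` times gives `M 0 ^ 4 ^ k ≤ M k`, while completing the square gives `M k ≤ (W / Z) *
exp C ^ 4 ^ k`. The prefactor is independent of `k`, so it disappears on taking `4 ^ k`-th roots. -/
theorem IsGaussianForm.mgf_le [IsAddTorsionFree Γ] {Q : Γ → ℝ} (hQ : IsGaussianForm Q)
    (X : Γ →+ ℝ) {C : ℝ} (hC : 0 ≤ C) (hX : ∀ x, X x ^ 2 ≤ C * Q x) :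
    (∑' x, Real.exp (-(1 / 2) * Q x + X x)) ≤
      Real.exp C * ∑' x, Real.exp (-(1 / 2) * Q x) := by
  set Z := ∑' x, Real.exp (-(1 / 2) * Q x) with hZ
  have hZpos : 0 < Z := hQ.tsum_pos
  set M : ℕ → ℝ := fun k => (∑' x, Real.exp (-(1 / 2) * Q x + 2 ^ k * X x)) / Z with hM
  have hXk : ∀ k : ℕ, ∀ x, (2 ^ k * X x) ^ 2 ≤ (4 ^ k * C) * Q x := fun k x => by
    have h4 : (4 : ℝ) ^ k = (2 ^ k) ^ 2 := by rw [← pow_mul, mul_comm, pow_mul]; norm_num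
    rw [h4, mul_pow, mul_assoc]
    exact mul_le_mul_of_nonneg_left (hX x) (by positivity)
  have hMnn : ∀ k, 0 ≤ M k := fun k =>
    div_nonneg (tsum_nonneg fun _ => (Real.exp_pos _).le) hZpos.le
  have hstep : ∀ k, M k ^ 4 ≤ M (k + 1) := fun k => by
    have h := hQ.mgf_pow_four_le ((AddMonoidHom.mulLeft ((2 : ℝ) ^ k)).comp X) (C := 4 ^ k * C)
      (hXk k)
    simp only [AddMonoidHom.comp_apply, AddMonoidHom.coe_mulLeft] at h
    rw [← hZ] at h
    simp only [hM]
    rw [div_pow, div_le_div_iff₀ (by positivity) hZpos, pow_succ' (2 : ℝ) k]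
    calc _ ≤ _ := mul_le_mul_of_nonneg_right h hZpos.le
      _ = _ := by
        simp only [mul_assoc]
        ring
  have hpow : ∀ k, M 0 ^ (4 ^ k) ≤ M k := by
    intro k
    induction k with
    | zero => simp
    | succ k ih =>
      calc M 0 ^ (4 ^ (k + 1)) = (M 0 ^ (4 ^ k)) ^ 4 := by rw [← pow_mul, pow_succ]
        _ ≤ M k ^ 4 := pow_le_pow_left₀ (pow_nonneg (hMnn 0) _) ih 4
        _ ≤ M (k + 1) := hstep k
  set W := ∑' x, Real.exp (-(1 / 4) * Q x) with hW
  have hub : ∀ k, M k ≤ (W / Z) * Real.exp C ^ (4 ^ k) := by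
    intro k
    simp only [hM]
    rw [div_mul_eq_mul_div]
    refine div_le_div_of_nonneg_right ?_ hZpos.le
    rw [hW, ← tsum_mul_right]
    refine (hQ.summable_exp_add (hXk k) (by norm_num)).tsum_le_tsum (fun x => ?_)
      ((hQ.summable _ (by norm_num)).mul_right _)
    rw [← Real.exp_nat_mul, ← Real.exp_add]
    refine Real.exp_le_exp.2 ?_
    push_cast
    have h4 := hXk k x
    -- Arithmetic–geometric mean: `(Q / 4 + D) ^ 2 ≥ D * Q` with `D = 4 ^ k * C`.
    have hd : 2 ^ k * X x ≤ 1 / 4 * Q x + 4 ^ k * C := by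
      by_contra! hcon
      have hC' : 0 ≤ 4 ^ k * C := by positivity
      nlinarith [hQ.nonneg x, sq_nonneg (1 / 4 * Q x - 4 ^ k * C)]
    linarith
  have hM0 : M 0 ≤ Real.exp C := by
    by_contra! hcon
    have hr : 1 < M 0 / Real.exp C := (one_lt_div (Real.exp_pos C)).2 hcon
    obtain ⟨k, hk⟩ := pow_unbounded_of_one_lt (W / Z) hr
    have h1 : (M 0 / Real.exp C) ^ k ≤ (M 0 / Real.exp C) ^ (4 ^ k) :=
      pow_le_pow_right₀ hr.le (Nat.lt_pow_self (by norm_num)).le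
    have h2 : (M 0 / Real.exp C) ^ (4 ^ k) ≤ W / Z := by
      rw [div_pow, div_le_iff₀ (by positivity)]
      exact (hpow k).trans (hub k)
    linarith
  simp only [hM, pow_zero, one_mul] at hM0
  rwa [div_le_iff₀ hZpos] at hM0

/-- A linear functional whose square is at most `C * Q` has second moment at most `12 * C`. -/
theorem IsGaussianForm.tsum_sq_le [IsAddTorsionFree Γ] {Q : Γ → ℝ} (hQ : IsGaussianForm Q)
    (X : Γ →+ ℝ) {C : ℝ} (hC : 0 < C) (hX : ∀ x, X x ^ 2 ≤ C * Q x) :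
    ∑' x, Real.exp (-(1 / 2) * Q x) * X x ^ 2 ≤ 12 * C * ∑' x, Real.exp (-(1 / 2) * Q x) := by
  set r : ℝ := (Real.sqrt C)⁻¹ with hr
  have hr2 : r ^ 2 * C = 1 := by
    rw [hr, inv_pow, Real.sq_sqrt hC.le, inv_mul_cancel₀ hC.ne']
  have bound : ∀ s : ℝ, s ^ 2 * C = 1 → (∀ x, (s * X x) ^ 2 ≤ 1 * Q x) ∧
      (∑' x, Real.exp (-(1 / 2) * Q x + s * X x)) ≤
        Real.exp 1 * ∑' x, Real.exp (-(1 / 2) * Q x) := by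
    intro s hs
    have h : ∀ x, (s * X x) ^ 2 ≤ 1 * Q x := fun x => by
      have := mul_le_mul_of_nonneg_left (hX x) (sq_nonneg s)
      rw [← mul_assoc, hs] at this
      rwa [mul_pow]
    exact ⟨h, hQ.mgf_le ((AddMonoidHom.mulLeft s).comp X) zero_le_one h⟩
  obtain ⟨h1, b1⟩ := bound r hr2
  obtain ⟨h2, b2⟩ := bound (-r) (by rw [neg_sq, hr2])
  have s1 := hQ.summable_exp_add h1 (t := 1 / 2) (by norm_num)
  have s2 := hQ.summable_exp_add h2 (t := 1 / 2) (by norm_num)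
  have hle : ∑' x, Real.exp (-(1 / 2) * Q x) * X x ^ 2 ≤
      ∑' x, 2 * C * (Real.exp (-(1 / 2) * Q x + r * X x) +
        Real.exp (-(1 / 2) * Q x + -r * X x)) := by
    refine (hQ.summable_exp_mul_sq hX (by norm_num)).tsum_le_tsum (fun x => ?_)
      ((s1.add s2).mul_left _)
    have h3 := mul_le_mul_of_nonneg_left (sq_div_two_le_exp_add_exp_neg (r * X x)) hC.le
    have h4 : C * ((r * X x) ^ 2 / 2) = X x ^ 2 / 2 := by
      rw [mul_pow, ← one_mul (X x ^ 2 / 2), ← hr2]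
      ring
    rw [h4] at h3
    rw [Real.exp_add, Real.exp_add, neg_mul r]
    nlinarith [mul_le_mul_of_nonneg_left h3 (Real.exp_pos (-(1 / 2) * Q x)).le]
  rw [tsum_mul_left, s1.tsum_add s2] at hle
  -- The accumulated constant is `4 * e * C`, and `e < 3`.
  have he := Real.exp_one_lt_d9
  have hZ := hQ.tsum_pos
  have h5 := mul_le_mul_of_nonneg_left (add_le_add b1 b2) (show 0 ≤ 2 * C by positivity)
  nlinarith [mul_pos hC hZ]

end Gaussian

/-! ### Ginibre-type inequality and monotonicity in the quadratic form -/

section Ginibre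

variable {Γ : Type*} [AddCommGroup Γ]

/-- Negative correlation of `X ^ 2` and `cos Y`. On two independent copies, both `X x ^ 2 - X y ^ 2`
and `cos (Y y) - cos (Y x)` factor into a function of `x + y` times the same function of `x - y`, so
the covariance is, up to sign, a self-pairing. -/
theorem IsGaussianForm.tsum_sq_mul_cos_le [IsAddTorsionFree Γ] {Q : Γ → ℝ} (hQ : IsGaussianForm Q)
    (X Y : Γ →+ ℝ) {C : ℝ} (hX : ∀ x, X x ^ 2 ≤ C * Q x) :
    (∑' x, Real.exp (-(1 / 2) * Q x) * X x ^ 2 * Real.cos (Y x)) *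
        (∑' x, Real.exp (-(1 / 2) * Q x)) ≤
      (∑' x, Real.exp (-(1 / 2) * Q x) * X x ^ 2) *
        ∑' x, Real.exp (-(1 / 2) * Q x) * Real.cos (Y x) := by
  have mulcos : ∀ f : Γ → ℝ, Summable f → Summable fun x => f x * Real.cos (Y x) := fun f hf =>
    Summable.of_norm_bounded hf.norm fun x => by
      rw [norm_mul]
      exact mul_le_of_le_one_right (norm_nonneg _) (Real.abs_cos_le_one _)
  have s0 := hQ.summable (1 / 2) (by norm_num)
  have s2 := hQ.summable_exp_mul_sq hX (t := 1 / 2) (by norm_num)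
  have s0c := mulcos _ s0
  have s2c := mulcos _ s2
  set F : Γ → ℝ := fun x => Real.exp (-(1 / 4) * Q x) * X x * Real.sin (Y x / 2) with hF
  have hFs : Summable F := by
    refine Summable.of_norm_bounded (hQ.summable_exp_mul hX (t := 1 / 4) (by norm_num)).norm
      fun x => ?_
    rw [hF, norm_mul]
    exact mul_le_of_le_one_right (norm_nonneg _) (Real.abs_sin_le_one _)
  set a : Γ × Γ → ℝ := fun p => Real.exp (-(1 / 2) * Q p.1) * X p.1 ^ 2 *
    (Real.exp (-(1 / 2) * Q p.2) * Real.cos (Y p.2)) -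
    Real.exp (-(1 / 2) * Q p.1) * X p.1 ^ 2 * Real.cos (Y p.1) * Real.exp (-(1 / 2) * Q p.2)
    with ha
  have sA := summable_mul_of_summable_norm s2.norm s0c.norm
  have sB := summable_mul_of_summable_norm s2c.norm s0.norm
  have sa : Summable a := sA.sub sB
  have e1 : ∑' p, a p = (∑' x, Real.exp (-(1 / 2) * Q x) * X x ^ 2) *
        (∑' x, Real.exp (-(1 / 2) * Q x) * Real.cos (Y x)) -
      (∑' x, Real.exp (-(1 / 2) * Q x) * X x ^ 2 * Real.cos (Y x)) *
        (∑' x, Real.exp (-(1 / 2) * Q x)) := by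
    rw [tsum_mul_tsum_of_summable_norm s2.norm s0c.norm,
      tsum_mul_tsum_of_summable_norm s2c.norm s0.norm, ← sA.tsum_sub sB]
  have e2 : ∑' p, a p = ∑' p : Γ × Γ, a p.swap := ((Equiv.prodComm Γ Γ).tsum_eq a).symm
  have e3 : (∑' p, a p) + ∑' p, a p = 2 * pairing F F := by
    nth_rewrite 2 [e2]
    have sa' : Summable fun p : Γ × Γ => a p.swap := (Equiv.prodComm Γ Γ).summable_iff.2 sa
    rw [← sa.tsum_add sa', pairing, ← tsum_mul_left]
    refine tsum_congr fun p => ?_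
    have hc : Real.cos (Y p.2) - Real.cos (Y p.1) =
        2 * (Real.sin (Y (p.1 + p.2) / 2) * Real.sin (Y (p.1 - p.2) / 2)) := by
      rw [Real.cos_sub_cos, map_add, map_sub, ← neg_sub (Y p.2), neg_div, Real.sin_neg,
        add_comm (Y p.2)]
      ring
    have hx : X p.1 ^ 2 - X p.2 ^ 2 = X (p.1 + p.2) * X (p.1 - p.2) := by
      rw [map_add, map_sub]
      ring
    simp only [ha, hF, Prod.fst_swap, Prod.snd_swap]
    calc _ = Real.exp (-(1 / 2) * Q p.1) * Real.exp (-(1 / 2) * Q p.2) *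
          ((X p.1 ^ 2 - X p.2 ^ 2) * (Real.cos (Y p.2) - Real.cos (Y p.1))) := by ring
      _ = _ := by
        rw [hQ.exp_mul_exp, hc, hx]
        ring
  have := pairing_self_nonneg hFs
  linarith

theorem integral_cos_mul_gaussianReal (y : ℝ) :
    ∫ θ, Real.cos (θ * y) ∂(gaussianReal 0 1) = Real.exp (-(1 / 2) * y ^ 2) := by
  have h := charFun_gaussianReal (μ := 0) (v := 1) y
  rw [charFun_apply_real] at h
  have hint : Integrable (fun θ : ℝ => Complex.exp (y * θ * Complex.I)) (gaussianReal 0 1) := by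
    refine Integrable.of_bound (C := 1) (by fun_prop) (Eventually.of_forall fun θ => ?_)
    rw [← Complex.ofReal_mul, Complex.norm_exp_ofReal_mul_I]
  have h2 := congrArg Complex.re h
  have h3 := integral_re hint
  simp only [RCLike.re_eq_complex_re] at h3
  rw [← h3] at h2
  calc _ = ∫ θ : ℝ, (Complex.exp (y * θ * Complex.I)).re ∂(gaussianReal 0 1) := by
        refine integral_congr_ae (Eventually.of_forall fun θ => ?_)
        simp only
        rw [← Complex.ofReal_mul, Complex.exp_ofReal_mul_I_re, mul_comm]
    _ = _ := by
        rw [h2]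
        have : (y : ℂ) * ((0 : ℝ) : ℂ) * Complex.I - (((1 : NNReal) : ℝ) : ℂ) * (y : ℂ) ^ 2 / 2 =
            ((-(1 / 2) * y ^ 2 : ℝ) : ℂ) := by
          push_cast
          ring
        rw [this, Complex.exp_ofReal_re]

/-- A Gaussian weight is an average of cosines over a standard normal frequency `θ`; this carries
the correlation inequality from `cos (θ * Y)` to `exp (-Y ^ 2 / 2)`. -/
theorem tsum_mul_exp_nonneg_of_cos {ι : Type*} [Countable ι] {b y : ι → ℝ} (hb : Summable b)
    (h : ∀ θ : ℝ, 0 ≤ ∑' x, b x * Real.cos (θ * y x)) :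
    0 ≤ ∑' x, b x * Real.exp (-(1 / 2) * y x ^ 2) := by
  have hint : ∀ x, Integrable (fun θ : ℝ => b x * Real.cos (θ * y x)) (gaussianReal 0 1) := fun x =>
    Integrable.of_bound (C := ‖b x‖) (by fun_prop) (Eventually.of_forall fun θ => by
      rw [norm_mul]
      exact mul_le_of_le_one_right (norm_nonneg _) (Real.abs_cos_le_one _))
  have hs : HasSum _ _ := hasSum_integral_of_summable_integral_norm hint (by
    refine Summable.of_nonneg_of_le (fun x => integral_nonneg fun _ => norm_nonneg _) (fun x => ?_)
      hb.norm
    calc _ ≤ ∫ θ : ℝ, ‖b x‖ ∂(gaussianReal 0 1) :=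
          integral_mono (hint x).norm (integrable_const _) fun θ => by
            rw [norm_mul]
            exact mul_le_of_le_one_right (norm_nonneg _) (Real.abs_cos_le_one _)
      _ = _ := by simp)
  have e : ∀ x, ∫ θ : ℝ, b x * Real.cos (θ * y x) ∂(gaussianReal 0 1) =
      b x * Real.exp (-(1 / 2) * y x ^ 2) := fun x => by
    rw [integral_const_mul, integral_cos_mul_gaussianReal]
  simp only [e] at hs
  rw [hs.tsum_eq]
  exact integral_nonneg h

/-- Adding the form `R` to any Gaussian form decreases the second moments of all linear
functionals. -/
structure Reinforces (R : Γ → ℝ) : Prop where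
  nonneg : ∀ x, 0 ≤ R x
  parallelogram : ∀ x y, R (x + y) + R (x - y) = 2 * R x + 2 * R y
  tsum_le : ∀ Q : Γ → ℝ, IsGaussianForm Q → ∀ (X : Γ →+ ℝ) (C : ℝ),
    (∀ x, X x ^ 2 ≤ C * Q x) →
    (∑' x, Real.exp (-(1 / 2) * (Q x + R x)) * X x ^ 2) * (∑' x, Real.exp (-(1 / 2) * Q x)) ≤
      (∑' x, Real.exp (-(1 / 2) * Q x) * X x ^ 2) * ∑' x, Real.exp (-(1 / 2) * (Q x + R x))

theorem IsGaussianForm.add {Q R : Γ → ℝ} (hQ : IsGaussianForm Q) (hR : ∀ x, 0 ≤ R x)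
    (hRp : ∀ x y, R (x + y) + R (x - y) = 2 * R x + 2 * R y) :
    IsGaussianForm fun x => Q x + R x where
  nonneg x := add_nonneg (hQ.nonneg x) (hR x)
  parallelogram x y := by linarith [hQ.parallelogram x y, hRp x y]
  summable t ht := Summable.of_nonneg_of_le (fun _ => (Real.exp_pos _).le)
    (fun x => Real.exp_le_exp.2 (by nlinarith [mul_nonneg ht.le (hR x)])) (hQ.summable t ht)

theorem reinforces_sq [IsAddTorsionFree Γ] [Countable Γ] (Y : Γ →+ ℝ) :
    Reinforces fun x => Y x ^ 2 where
  nonneg x := sq_nonneg _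
  parallelogram x y := by
    rw [map_add, map_sub]
    ring
  tsum_le Q hQ X C hX := by
    have s0 := hQ.summable (1 / 2) (by norm_num)
    have s2 := hQ.summable_exp_mul_sq hX (t := 1 / 2) (by norm_num)
    set Z := ∑' x, Real.exp (-(1 / 2) * Q x) with hZ
    set S := ∑' x, Real.exp (-(1 / 2) * Q x) * X x ^ 2 with hS
    -- A signed weight for which `0 ≤ ∑ b * g` says that `X ^ 2` and `g` are negatively correlated.
    set b : Γ → ℝ := fun x => S * Real.exp (-(1 / 2) * Q x) -
      Z * (Real.exp (-(1 / 2) * Q x) * X x ^ 2) with hb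
    have hbs : Summable b := (s0.mul_left S).sub (s2.mul_left Z)
    have expand : ∀ g : Γ → ℝ, (∀ x, |g x| ≤ 1) → ∑' x, b x * g x =
        S * (∑' x, Real.exp (-(1 / 2) * Q x) * g x) -
          (∑' x, Real.exp (-(1 / 2) * Q x) * X x ^ 2 * g x) * Z := by
      intro g hg
      have bd : ∀ f : Γ → ℝ, Summable f → Summable fun x => f x * g x := fun f hf =>
        Summable.of_norm_bounded hf.norm fun x => by
          rw [norm_mul]
          exact mul_le_of_le_one_right (norm_nonneg _) (hg x)
      rw [mul_comm _ Z, ← tsum_mul_left, ← tsum_mul_left,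
        ← ((bd _ s0).mul_left S).tsum_sub ((bd _ s2).mul_left Z)]
      refine tsum_congr fun x => ?_
      simp only [hb]
      ring
    have key := tsum_mul_exp_nonneg_of_cos (y := Y) hbs fun θ => by
      rw [expand _ fun x => Real.abs_cos_le_one _]
      exact sub_nonneg.2 (hQ.tsum_sq_mul_cos_le X ((AddMonoidHom.mulLeft θ).comp Y) hX)
    rw [expand _ fun x => by
      rw [Real.abs_exp]
      exact Real.exp_le_one_iff.2 (by nlinarith [sq_nonneg (Y x)])] at key
    have h1 : ∀ x, Real.exp (-(1 / 2) * (Q x + Y x ^ 2)) =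
        Real.exp (-(1 / 2) * Q x) * Real.exp (-(1 / 2) * Y x ^ 2) := fun x => by
      rw [← Real.exp_add, mul_add]
    have h2 : ∀ x, Real.exp (-(1 / 2) * (Q x + Y x ^ 2)) * X x ^ 2 =
        Real.exp (-(1 / 2) * Q x) * X x ^ 2 * Real.exp (-(1 / 2) * Y x ^ 2) := fun x => by
      rw [h1]
      ring
    rw [tsum_congr h1, tsum_congr h2]
    exact sub_nonneg.1 key

theorem reinforces_mul_sq [IsAddTorsionFree Γ] [Countable Γ] {c : ℝ} (hc : 0 ≤ c) (Y : Γ →+ ℝ) :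
    Reinforces fun x => c * Y x ^ 2 := by
  have h := reinforces_sq ((AddMonoidHom.mulLeft (Real.sqrt c)).comp Y)
  simpa [mul_pow, Real.sq_sqrt hc] using h

theorem reinforces_zero : Reinforces fun _ : Γ => (0 : ℝ) where
  nonneg _ := le_rfl
  parallelogram _ _ := by ring
  tsum_le Q _ X C _ := by simp

theorem Reinforces.add {R S : Γ → ℝ} (hR : Reinforces R) (hS : Reinforces S) :
    Reinforces fun x => R x + S x where
  nonneg x := add_nonneg (hR.nonneg x) (hS.nonneg x)
  parallelogram x y := by linarith [hR.parallelogram x y, hS.parallelogram x y]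
  tsum_le Q hQ X C hX := by
    wlog hC : 0 ≤ C generalizing C
    · exact this 0 (fun x => (hX x).trans
        (mul_le_mul_of_nonneg_right (by linarith) (hQ.nonneg x))) le_rfl
    have hQR := hQ.add hR.nonneg hR.parallelogram
    have h1 := hR.tsum_le Q hQ X C hX
    have h2 := hS.tsum_le _ hQR X C fun x => (hX x).trans
      (mul_le_mul_of_nonneg_left (by linarith [hR.nonneg x]) hC)
    simp only [add_assoc] at h2
    have hZ1 := hQR.tsum_pos
    have hZ0 := hQ.tsum_pos
    have hZ2 : 0 ≤ ∑' x, Real.exp (-(1 / 2) * (Q x + (R x + S x))) :=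
      tsum_nonneg fun _ => (Real.exp_pos _).le
    -- Both inequalities compare ratios through the intermediate form `Q + R`; its positive
    -- partition function is cancelled.
    refine le_of_mul_le_mul_right ?_ hZ1
    nlinarith [mul_le_mul_of_nonneg_right h1 hZ2, mul_le_mul_of_nonneg_right h2 hZ0.le]

theorem reinforces_sum {ι : Type*} (s : Finset ι) {R : ι → Γ → ℝ}
    (hR : ∀ i ∈ s, Reinforces (R i)) : Reinforces fun x => ∑ i ∈ s, R i x := by
  classical
  induction s using Finset.induction_on with
  | empty => simpa using reinforces_zero
  | insert i s hi ih =>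
    simp only [Finset.sum_insert hi]
    exact (hR i (Finset.mem_insert_self i s)).add
      (ih fun j hj => hR j (Finset.mem_insert_of_mem hj))

theorem tendsto_tsum_exp_mul {ι : Type*} {Q : ι → ℝ} {κ : Type*}
    {l : Filter κ} {R : κ → ι → ℝ} (hR : ∀ k x, 0 ≤ R k x) {g ρ : ι → ℝ}
    (hlim : ∀ x, Tendsto (fun k => Real.exp (-(1 / 2) * R k x)) l (𝓝 (ρ x)))
    (hg : Summable fun x => Real.exp (-(1 / 2) * Q x) * g x) :
    Tendsto (fun k => ∑' x, Real.exp (-(1 / 2) * (Q x + R k x)) * g x) l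
      (𝓝 (∑' x, ρ x * (Real.exp (-(1 / 2) * Q x) * g x))) := by
  have e : ∀ k x, Real.exp (-(1 / 2) * (Q x + R k x)) * g x =
      Real.exp (-(1 / 2) * R k x) * (Real.exp (-(1 / 2) * Q x) * g x) := fun k x => by
    rw [mul_add, Real.exp_add]
    ring
  simp only [e]
  refine tendsto_tsum_of_dominated_convergence hg.norm (fun x => (hlim x).mul_const _)
    (Eventually.of_forall fun k x => ?_)
  rw [norm_mul]
  refine mul_le_of_le_one_left (norm_nonneg _) ?_
  rw [Real.norm_eq_abs, Real.abs_exp]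
  exact Real.exp_le_one_iff.2 (by linarith [hR k x])

/-- The second moment bound for a weight that is a limit of the weights of reinforcing forms. -/
theorem tsum_sq_le_of_tendsto {Q : Γ → ℝ} (hQ : IsGaussianForm Q)
    (X : Γ →+ ℝ) {C : ℝ} (hX : ∀ x, X x ^ 2 ≤ C * Q x) {κ : Type*} {l : Filter κ} [l.NeBot]
    {R : κ → Γ → ℝ} (hR : ∀ k, Reinforces (R k)) {ρ : Γ → ℝ}
    (hlim : ∀ x, Tendsto (fun k => Real.exp (-(1 / 2) * R k x)) l (𝓝 (ρ x))) :
    (∑' x, ρ x * (Real.exp (-(1 / 2) * Q x) * X x ^ 2)) * (∑' x, Real.exp (-(1 / 2) * Q x)) ≤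
      (∑' x, Real.exp (-(1 / 2) * Q x) * X x ^ 2) *
        ∑' x, ρ x * (Real.exp (-(1 / 2) * Q x)) := by
  have s0 := hQ.summable (1 / 2) (by norm_num)
  have s2 := hQ.summable_exp_mul_sq hX (t := 1 / 2) (by norm_num)
  have l2 := tendsto_tsum_exp_mul (fun k => (hR k).nonneg) hlim s2
  have l0 := tendsto_tsum_exp_mul (Q := Q) (g := fun _ => 1)
    (fun k => (hR k).nonneg) hlim (by simpa using s0)
  simp only [mul_one] at l0
  exact le_of_tendsto_of_tendsto' (l2.mul_const _) (l0.const_mul _)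
    fun k => (hR k).tsum_le Q hQ X C hX

/-- Needed because infinitely many pairs of sites interact; the weights of the finite partial sums
converge and are dominated by the weight of `Q`. -/
theorem reinforces_of_hasSum {ι : Type*} {R : ι → Γ → ℝ} (hR : ∀ i, Reinforces (R i)) {S : Γ → ℝ}
    (hS : ∀ x, HasSum (fun i => R i x) (S x)) : Reinforces S where
  nonneg x := (hS x).nonneg fun i => (hR i).nonneg x
  parallelogram x y := by
    refine HasSum.unique ((hS (x + y)).add (hS (x - y))) ?_
    simp only [(hR _).parallelogram]
    exact ((hS x).mul_left 2).add ((hS y).mul_left 2)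
  tsum_le Q hQ X C hX := by
    have h := tsum_sq_le_of_tendsto hQ X hX (l := atTop) (R := fun s x => ∑ i ∈ s, R i x)
      (fun s => reinforces_sum s fun i _ => hR i)
      (ρ := fun x => Real.exp (-(1 / 2) * S x))
      (fun x => (Real.continuous_exp.tendsto _).comp (Tendsto.const_mul _ (hS x)))
    have e : ∀ x, Real.exp (-(1 / 2) * (Q x + S x)) =
      Real.exp (-(1 / 2) * S x) * Real.exp (-(1 / 2) * Q x) := fun x => by
        rw [← Real.exp_add]
        ring_nf
    simp only [e, mul_assoc]
    exact h

end Ginibre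

/-! ### Gaussian sums over the integers and random walk moments -/

section LatticeSums

theorem summable_exp_neg_mul_sq {c : ℝ} (hc : 0 < c) :
    Summable fun k : ℤ => Real.exp (-c * (k : ℝ) ^ 2) := by
  have h : Summable fun k : ℕ => Real.exp (-c * ((k : ℤ) : ℝ) ^ 2) := by
    refine Summable.of_nonneg_of_le (fun _ => (Real.exp_pos _).le) (fun k => ?_)
      (Real.summable_exp_nat_mul_iff.2 (neg_lt_zero.2 hc))
    refine Real.exp_le_exp.2 ?_
    have h1 : (k : ℝ) ≤ (k : ℝ) ^ 2 := by
      exact_mod_cast Nat.le_self_pow two_ne_zero k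
    push_cast
    nlinarith
  refine Summable.of_nat_of_neg h ?_
  simpa using h

theorem summable_exp_neg_mul_sq_mul_sq {c : ℝ} (hc : 0 < c) :
    Summable fun k : ℤ => Real.exp (-c * (k : ℝ) ^ 2) * (k : ℝ) ^ 2 := by
  refine Summable.of_nonneg_of_le (fun _ => by positivity) (fun k => ?_)
    ((summable_exp_neg_mul_sq (half_pos hc)).mul_left (2 / c))
  have h1 : c / 2 * (k : ℝ) ^ 2 ≤ Real.exp (c / 2 * (k : ℝ) ^ 2) := by
    linarith [Real.add_one_le_exp (c / 2 * (k : ℝ) ^ 2)]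
  have h2 : Real.exp (-c * (k : ℝ) ^ 2) * Real.exp (c / 2 * (k : ℝ) ^ 2) =
      Real.exp (-(c / 2) * (k : ℝ) ^ 2) := by
    rw [← Real.exp_add]
    ring_nf
  rw [← h2, div_mul_eq_mul_div, le_div_iff₀ hc]
  nlinarith [mul_le_mul_of_nonneg_left h1 (Real.exp_pos (-c * (k : ℝ) ^ 2)).le]

/-- The partition function, first and second moments of the endpoint of a random walk on `ℤ` whose
steps have the symmetric weight `g`. -/
theorem hasSum_walk {g : ℤ → ℝ} (hg0 : ∀ k, 0 ≤ g k) (hge : ∀ k, g (-k) = g k)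
    (hg : Summable g) (hg2 : Summable fun k => g k * (k : ℝ) ^ 2) (hz : ∑' k, g k ≠ 0) (m : ℕ) :
    HasSum (fun ξ : Fin m → ℤ => ∏ i, g (ξ i)) ((∑' k, g k) ^ m) ∧
    HasSum (fun ξ : Fin m → ℤ => (∏ i, g (ξ i)) * ∑ i, (ξ i : ℝ)) 0 ∧
    HasSum (fun ξ : Fin m → ℤ => (∏ i, g (ξ i)) * (∑ i, (ξ i : ℝ)) ^ 2)
      (m * ((∑' k, g k * (k : ℝ) ^ 2) / ∑' k, g k) * (∑' k, g k) ^ m) := by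
  set z := ∑' k, g k with hzdef
  set s := ∑' k, g k * (k : ℝ) ^ 2 with hs
  have hg1 : Summable fun k => g k * (k : ℝ) := by
    refine Summable.of_norm_bounded (hg.add hg2) fun k => ?_
    rw [norm_mul, Real.norm_eq_abs, abs_of_nonneg (hg0 k), Real.norm_eq_abs]
    have : |(k : ℝ)| ≤ 1 + (k : ℝ) ^ 2 := by
      nlinarith [sq_abs (k : ℝ), sq_nonneg (|(k : ℝ)| - 1)]
    nlinarith [hg0 k]
  have hg1z : HasSum (fun k => g k * (k : ℝ)) 0 := by
    have h := hg1.hasSum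
    have h' : HasSum (fun k => -(g k * (k : ℝ))) (∑' k, g k * (k : ℝ)) := by
      refine ((Equiv.neg ℤ).hasSum_iff.2 h).congr_fun ?_ |> id
      intro k
      simp [hge]
    have := h'.unique h.neg
    have h0 : ∑' k, g k * (k : ℝ) = 0 := by linarith
    rwa [h0] at h
  induction m with
  | zero =>
    refine ⟨?_, ?_, ?_⟩
    · simp
    · simp
    · simp
  | succ m ih =>
    obtain ⟨i0, i1, i2⟩ := ih
    have mul : ∀ {u : ℤ → ℝ} {v : (Fin m → ℤ) → ℝ} {a b : ℝ}, HasSum u a → HasSum v b →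
        HasSum (fun p : ℤ × (Fin m → ℤ) => u p.1 * v p.2) (a * b) := fun hu hv =>
      hu.mul hv (summable_mul_of_summable_norm hu.summable.norm hv.summable.norm)
    have e := fun (f : (Fin (m + 1) → ℤ) → ℝ) (a : ℝ) =>
      (Fin.consEquiv (fun _ : Fin (m + 1) => ℤ)).hasSum_iff (f := f) (a := a)
    refine ⟨(e _ _).1 ?_, (e _ _).1 ?_, (e _ _).1 ?_⟩
    · convert mul hg.hasSum i0 using 1
      · ext p
        simp [Fin.prod_univ_succ, Fin.consEquiv]
      · rw [pow_succ']
    · convert (mul hg.hasSum i1).add (mul hg1z i0) using 1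
      · ext p
        simp [Fin.prod_univ_succ, Fin.sum_univ_succ, Fin.consEquiv]
        ring
      · ring
    -- Square of the first step plus the rest; the cross term vanishes because steps are centred.
    · convert ((mul hg.hasSum i2).add ((mul hg1z i1).mul_left 2)).add (mul hg2.hasSum i0) using 1
      · ext p
        simp [Fin.prod_univ_succ, Fin.sum_univ_succ, Fin.consEquiv]
        ring
      · rw [← hzdef, ← hs, pow_succ']
        push_cast
        field_simp
        ring

theorem summable_pi_prod {g : ℤ → ℝ} (hg : Summable g) (m : ℕ) :
    Summable fun ξ : Fin m → ℤ => ∏ i, g (ξ i) := by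
  induction m with
  | zero => exact (hasSum_unique _).summable
  | succ m ih =>
    refine (Fin.consEquiv (fun _ : Fin (m + 1) => ℤ)).summable_iff.1 ?_
    refine (summable_mul_of_summable_norm hg.norm ih.norm).congr fun p => ?_
    simp [Fin.prod_univ_succ, Fin.consEquiv]

end LatticeSums

/-! ### The energy as a Gaussian form on configurations -/

section Chain

/-- The group structure on the configurations. -/
def configSubgroup (n : ℕ) : AddSubgroup (ℤ → ℤ) where
  carrier := {h | ∀ i : ℤ, i ∉ Set.Icc (-(n : ℤ)) (n : ℤ) → h i = 0}
  zero_mem' _ _ := rfl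
  add_mem' ha hb i hi := by simp [ha i hi, hb i hi]
  neg_mem' ha i hi := by simp [ha i hi]

instance (n : ℕ) : AddCommGroup (Config n) := inferInstanceAs (AddCommGroup (configSubgroup n))

theorem Config.coe_add {n : ℕ} (h k : Config n) (i : ℤ) : (h + k).1 i = h.1 i + k.1 i := rfl

theorem Config.coe_sub {n : ℕ} (h k : Config n) (i : ℤ) : (h - k).1 i = h.1 i - k.1 i := rfl

theorem Config.coe_neg {n : ℕ} (h : Config n) (i : ℤ) : (-h).1 i = -h.1 i := rfl

instance (n : ℕ) : IsAddTorsionFree (Config n) :=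
  inferInstanceAs (IsAddTorsionFree (configSubgroup n))

/-- The height at `x` as a linear functional of the configuration. -/
def heightHom (n : ℕ) (x : ℤ) : Config n →+ ℝ where
  toFun h := (h.1 x : ℝ)
  map_zero' := by
    change (((0 : ℤ) : ℤ) : ℝ) = 0
    simp
  map_add' h k := by rw [Config.coe_add]; push_cast; rfl

theorem heightHom_apply {n : ℕ} (x : ℤ) (h : Config n) : heightHom n x h = (h.1 x : ℝ) := rfl

theorem injective_coordinates (n : ℕ) :
    Function.Injective fun (h : Config n) (i : Fin (2 * n + 1)) => h.1 ((i : ℤ) - n) := by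
  intro h k e
  refine Subtype.ext (funext fun x => ?_)
  by_cases hx : x ∈ Set.Icc (-(n : ℤ)) (n : ℤ)
  · have h1 := hx.1
    have h2 := hx.2
    have h3 := congrFun e ⟨(x + n).toNat, by omega⟩
    have h4 : (((x + n).toNat : ℕ) : ℤ) - n = x := by omega
    simpa only [h4] using h3
  · rw [h.2 x hx, k.2 x hx]

instance (n : ℕ) : Countable (Config n) := (injective_coordinates n).countable

theorem IsCoupling.pos {α : ℝ} {J : ℕ → ℝ} (hJ : IsCoupling α J) {r : ℕ} (hr : 1 ≤ r) :
    0 < J r := by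
  obtain ⟨a, A, ha, -, h⟩ := hJ
  have hr' : (0 : ℝ) < r := by exact_mod_cast hr
  exact (mul_pos ha (Real.rpow_pos_of_pos hr' _)).trans_le (h r hr).1

/-- The contribution of an ordered pair of sites to the energy. -/
noncomputable def energyTerm (J : ℕ → ℝ) (h : ℤ → ℤ) (p : ℤ × ℤ) : ℝ :=
  if p.1 ≠ p.2 then J (p.1 - p.2).natAbs * ((h p.1 : ℝ) - (h p.2 : ℝ)) ^ 2 else 0

theorem energyTerm_of_ne {J : ℕ → ℝ} {h : ℤ → ℤ} {i j : ℤ} (hij : i ≠ j) :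
    energyTerm J h (i, j) = J (i - j).natAbs * ((h i : ℝ) - (h j : ℝ)) ^ 2 :=
  if_pos hij

theorem IsCoupling.energyTerm_nonneg {α : ℝ} {J : ℕ → ℝ} (hJ : IsCoupling α J) (h : ℤ → ℤ)
    (p : ℤ × ℤ) : 0 ≤ energyTerm J h p := by
  rw [energyTerm]
  split_ifs with hp
  · exact mul_nonneg (hJ.pos (by have := sub_ne_zero.2 hp; omega)).le (sq_nonneg _)
  · exact le_rfl

theorem IsCoupling.summable_int {α : ℝ} {J : ℕ → ℝ} (hJ : IsCoupling α J) (hα : 1 < α) :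
    Summable fun r : ℤ => if r ≠ 0 then J r.natAbs else 0 := by
  have hpos := fun r : ℕ => hJ.pos (r := r)
  obtain ⟨a, A, ha, hA, h⟩ := hJ
  refine Summable.of_nonneg_of_le (fun r => ?_) (fun r => ?_)
    ((Real.summable_abs_int_rpow hα).mul_left A)
  · split_ifs with hr
    · exact (hpos _ (by omega)).le
    · exact le_rfl
  · split_ifs with hr
    · have := (h r.natAbs (by omega)).2
      rwa [Nat.cast_natAbs, Int.cast_abs] at this
    · positivity

theorem summable_mul_sub {f c : ℤ → ℝ} (hf : Summable f) (hc : Summable c) :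
    Summable fun p : ℤ × ℤ => f p.1 * c (p.1 - p.2) := by
  have hprod : Summable fun p : ℤ × ℤ => f p.1 * c p.2 :=
    summable_mul_of_summable_norm hf.norm hc.norm
  have hinj : Function.Injective fun p : ℤ × ℤ => (p.1, p.1 - p.2) := by
    rintro ⟨a, b⟩ ⟨a', b'⟩ e
    simp only [Prod.mk.injEq] at e ⊢
    omega
  exact hprod.comp_injective hinj

theorem IsCoupling.summable_energyTerm {α : ℝ} {J : ℕ → ℝ} (hJ : IsCoupling α J) (hα : 1 < α)
    {n : ℕ} (h : Config n) : Summable (energyTerm J h.1) := by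
  set c : ℤ → ℝ := fun r => if r ≠ 0 then J r.natAbs else 0 with hc
  have hcs : Summable c := hJ.summable_int hα
  have hc0 : ∀ r, 0 ≤ c r := fun r => by
    simp only [hc]
    split_ifs with hr
    · exact (hJ.pos (by omega)).le
    · exact le_rfl
  have hsq : Summable fun i : ℤ => (h.1 i : ℝ) ^ 2 :=
    summable_of_ne_finset_zero (s := Finset.Icc (-(n : ℤ)) n) fun i hi => by
      rw [h.2 i (by simpa using hi)]
      simp
  have s1 : Summable fun p : ℤ × ℤ => (h.1 p.1 : ℝ) ^ 2 * c (p.1 - p.2) :=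
    summable_mul_sub hsq hcs
  have s2 : Summable fun p : ℤ × ℤ => (h.1 p.2 : ℝ) ^ 2 * c (p.1 - p.2) := by
    have hs := summable_mul_sub hsq ((Equiv.neg ℤ).summable_iff.2 hcs)
    refine ((Equiv.prodComm ℤ ℤ).summable_iff.2 hs).congr fun p => ?_
    simp
  refine Summable.of_nonneg_of_le (hJ.energyTerm_nonneg h.1) (fun p => ?_)
    ((s1.mul_left 2).add (s2.mul_left 2))
  have e : energyTerm J h.1 p = c (p.1 - p.2) * ((h.1 p.1 : ℝ) - h.1 p.2) ^ 2 := by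
    simp only [energyTerm, hc, ne_eq, sub_eq_zero]
    split_ifs <;> simp
  rw [e]
  nlinarith [mul_nonneg (hc0 (p.1 - p.2)) (sq_nonneg ((h.1 p.1 : ℝ) + h.1 p.2))]

theorem IsCoupling.hasSum_energy {α : ℝ} {J : ℕ → ℝ} (hJ : IsCoupling α J) (hα : 1 < α)
    {n : ℕ} (h : Config n) : HasSum (energyTerm J h.1) (energy J h.1) :=
  (hJ.summable_energyTerm hα h).hasSum

theorem IsCoupling.sum_energyTerm_le {α : ℝ} {J : ℕ → ℝ} (hJ : IsCoupling α J) (hα : 1 < α)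
    {n : ℕ} (h : Config n) {ι : Type*} (s : Finset ι) {f : ι → ℤ × ℤ}
    (hf : Set.InjOn f s) : ∑ i ∈ s, energyTerm J h.1 (f i) ≤ energy J h.1 := by
  classical
  rw [← Finset.sum_image (f := energyTerm J h.1) hf]
  exact sum_le_hasSum _ (fun p _ => hJ.energyTerm_nonneg h.1 p) (hJ.hasSum_energy hα h)

theorem IsCoupling.energy_nonneg {α : ℝ} {J : ℕ → ℝ} (hJ : IsCoupling α J) (h : ℤ → ℤ) :
    0 ≤ energy J h := tsum_nonneg (hJ.energyTerm_nonneg h)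

theorem IsCoupling.energy_parallelogram {α : ℝ} {J : ℕ → ℝ} (hJ : IsCoupling α J) (hα : 1 < α)
    {n : ℕ} (h k : Config n) : energy J (h + k).1 + energy J (h - k).1 =
      2 * energy J h.1 + 2 * energy J k.1 := by
  have e : ∀ p, energyTerm J (h + k).1 p + energyTerm J (h - k).1 p =
      2 * energyTerm J h.1 p + 2 * energyTerm J k.1 p := fun p => by
    simp only [energyTerm, Config.coe_add, Config.coe_sub]
    split_ifs
    · push_cast
      ring
    · simp
  have h1 := (hJ.hasSum_energy hα (h + k)).add (hJ.hasSum_energy hα (h - k))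
  simp only [e] at h1
  exact h1.unique (((hJ.hasSum_energy hα h).mul_left 2).add ((hJ.hasSum_energy hα k).mul_left 2))

/-- Telescoping from `x` to the boundary and Cauchy–Schwarz, using only the coupling at distance
`1`. This yields both the convergence of the partition function and the linear upper bound on the
variance. -/
theorem IsCoupling.exists_sq_le_nearest {α : ℝ} {J : ℕ → ℝ} (hJ : IsCoupling α J) (hα : 1 < α) :
    ∃ a : ℝ, 0 < a ∧ ∀ (n : ℕ) (h : Config n) (x : ℤ),
      (h.1 x : ℝ) ^ 2 ≤ (2 * n + 1) / a * energy J h.1 := by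
  have hJ' := hJ
  obtain ⟨a, A, ha, hA, hb⟩ := hJ'
  refine ⟨a, ha, fun n h x => ?_⟩
  have hE := hJ.energy_nonneg h.1
  by_cases hx : x ∈ Set.Icc (-(n : ℤ)) (n : ℤ)
  swap
  · rw [h.2 x hx]
    simp only [Int.cast_zero, ne_eq, OfNat.ofNat_ne_zero, not_false_eq_true, zero_pow]
    positivity
  obtain ⟨h1, h2⟩ := hx
  -- The path ends at `n + 1`, the first site to the right where `h` must vanish.
  set m := (n + 1 - x).toNat with hm
  have htel : ∑ i ∈ Finset.range m, ((h.1 (x + i) : ℝ) - h.1 (x + (i + 1 : ℕ))) = h.1 x := by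
    rw [Finset.sum_range_sub' (fun i : ℕ => (h.1 (x + i) : ℝ))]
    rw [h.2 (x + m) (by simp only [Set.mem_Icc]; omega)]
    simp
  have hcs := sq_sum_le_card_mul_sum_sq (s := Finset.range m)
    (f := fun i : ℕ => (h.1 (x + i) : ℝ) - h.1 (x + (i + 1 : ℕ)))
  rw [htel, Finset.card_range] at hcs
  have hsum := hJ.sum_energyTerm_le hα h (Finset.range m)
    (f := fun i : ℕ => (x + i, x + (i + 1 : ℕ))) (by
      intro i _ j _ e
      simp only [Prod.mk.injEq] at e
      omega)
  have hterm : ∀ i ∈ Finset.range m, a * ((h.1 (x + i) : ℝ) - h.1 (x + (i + 1 : ℕ))) ^ 2 ≤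
      energyTerm J h.1 (x + i, x + (i + 1 : ℕ)) := by
    intro i _
    rw [energyTerm_of_ne (by push_cast; omega)]
    have e1 : (x + i - (x + (i + 1 : ℕ))).natAbs = 1 := by omega
    rw [e1]
    have := (hb 1 le_rfl).1
    simp only [Nat.cast_one, Real.one_rpow, mul_one] at this
    exact mul_le_mul_of_nonneg_right this (sq_nonneg _)
  have hfin := (Finset.sum_le_sum hterm).trans hsum
  rw [← Finset.mul_sum] at hfin
  have hm' : (m : ℝ) ≤ 2 * n + 1 := by
    have : m ≤ 2 * n + 1 := by omega
    exact_mod_cast this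
  rw [div_mul_eq_mul_div, le_div_iff₀ ha]
  calc _ ≤ (m * ∑ i ∈ Finset.range m, ((h.1 (x + i) : ℝ) - h.1 (x + (i + 1 : ℕ))) ^ 2) * a :=
        mul_le_mul_of_nonneg_right hcs ha.le
    _ = m * (a * ∑ i ∈ Finset.range m, ((h.1 (x + i) : ℝ) - h.1 (x + (i + 1 : ℕ))) ^ 2) := by ring
    _ ≤ (2 * n + 1) * energy J h.1 := by gcongr

theorem IsCoupling.isGaussianForm {α : ℝ} {J : ℕ → ℝ} (hJ : IsCoupling α J) (hα : 1 < α)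
    (n : ℕ) {β : ℝ} (hβ : 0 < β) : IsGaussianForm fun h : Config n => β * energy J h.1 where
  nonneg h := mul_nonneg hβ.le (hJ.energy_nonneg h.1)
  parallelogram h k := by linear_combination β * hJ.energy_parallelogram hα h k
  summable t ht := by
    obtain ⟨a, ha, hle⟩ := hJ.exists_sq_le_nearest hα
    -- Summing the pointwise bound over the `2 * n + 1` sites dominates the weight by a product of
    -- one-dimensional Gaussians.
    set D : ℝ := (2 * n + 1) * ((2 * n + 1) / a) with hD
    have hDpos : 0 < D := by positivity
    have hsum : ∀ h : Config n, ∑ i : Fin (2 * n + 1), (h.1 ((i : ℤ) - n) : ℝ) ^ 2 ≤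
        D * energy J h.1 := fun h => by
      calc _ ≤ ∑ i : Fin (2 * n + 1), ((2 * n + 1) / a * energy J h.1) :=
            Finset.sum_le_sum fun i _ => hle n h _
        _ = _ := by
          rw [Finset.sum_const, Finset.card_univ, Fintype.card_fin, nsmul_eq_mul, hD]
          push_cast
          ring
    have hs := (summable_pi_prod
      (summable_exp_neg_mul_sq (show 0 < t * β / D by positivity)) (2 * n + 1)).comp_injective
      (injective_coordinates n)
    refine Summable.of_nonneg_of_le (fun _ => (Real.exp_pos _).le) (fun h => ?_) hs
    simp only [Function.comp_apply]
    rw [← Real.exp_sum, ← Finset.mul_sum]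
    refine Real.exp_le_exp.2 ?_
    have := mul_le_mul_of_nonneg_left (hsum h) (show 0 ≤ t * β / D by positivity)
    have e : t * β / D * (D * energy J h.1) = t * (β * energy J h.1) := by field_simp
    linarith

end Chain

/-! ### Uniform control of heights by the energy for `α < 2` -/

section Transience

theorem Config.tendsto_dyadic_average {n : ℕ} (h : Config n) (x : ℤ) :
    Tendsto (fun k : ℕ => (∑ i ∈ Finset.range (2 ^ k), (h.1 (x + i) : ℝ)) / 2 ^ k) atTop (𝓝 0) := by
  have hs : Summable fun i : ℕ => |(h.1 (x + i) : ℝ)| := by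
    refine summable_of_ne_finset_zero (s := Finset.range (n + 1 - x).toNat) fun i hi => ?_
    rw [h.2 (x + i)]
    · simp
    · simp only [Finset.mem_range, not_lt, Set.mem_Icc] at hi ⊢
      omega
  refine squeeze_zero_norm (a := fun k : ℕ => (∑' i : ℕ, |(h.1 (x + i) : ℝ)|) * (1 / 2) ^ k)
    (fun k => ?_) ?_
  · rw [norm_div, norm_pow, Real.norm_ofNat, one_div, inv_pow, ← div_eq_mul_inv]
    gcongr
    exact (norm_sum_le _ _).trans (hs.sum_le_tsum _ fun _ _ => abs_nonneg _)
  · simpa using (tendsto_pow_atTop_nhds_zero_of_lt_one (r := (1 / 2 : ℝ)) (by norm_num)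
      (by norm_num)).const_mul (∑' i : ℕ, |(h.1 (x + i) : ℝ)|)

/-- With `N = 2 ^ k`, the increment is half the difference of the averages over two adjacent blocks
of length `N`, hence an average over `N ^ 2` pairs of sites. Each pair is at distance at most `2 *
N`, so its coupling is at least `a * (2 * N) ^ (-α)`; Cauchy–Schwarz gives the bound. -/
theorem IsCoupling.sq_dyadic_increment_le {α a : ℝ} {J : ℕ → ℝ} (hJ : IsCoupling α J) (hα : 1 < α)
    (ha : 0 < a) (hb : ∀ r : ℕ, 1 ≤ r → a * (r : ℝ) ^ (-α) ≤ J r) {n : ℕ} (h : Config n) (x : ℤ)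
    (k : ℕ) :
    ((∑ i ∈ Finset.range (2 ^ k), (h.1 (x + i) : ℝ)) / 2 ^ k -
      (∑ i ∈ Finset.range (2 ^ (k + 1)), (h.1 (x + i) : ℝ)) / 2 ^ (k + 1)) ^ 2 ≤
    energy J h.1 / a * ((2 : ℝ) ^ (k + 1)) ^ (α - 2) := by
  set N : ℕ := 2 ^ k with hN
  have hNR : (2 : ℝ) ^ k = N := by rw [hN]; push_cast; rfl
  have hNpos : (0 : ℝ) < N := by rw [← hNR]; positivity
  set s := Finset.range N ×ˢ Finset.range N with hs
  set d : ℕ × ℕ → ℝ := fun p => (h.1 (x + p.1) : ℝ) - h.1 (x + (N + p.2 : ℕ)) with hd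
  have hD : ∑ p ∈ s, d p = N * (∑ i ∈ Finset.range N, (h.1 (x + i) : ℝ)) -
      N * ∑ i ∈ Finset.range N, (h.1 (x + (N + i : ℕ)) : ℝ) := by
    simp only [hs, hd, Finset.sum_sub_distrib, Finset.sum_product, Finset.sum_const,
      Finset.card_range, nsmul_eq_mul, ← Finset.mul_sum]
  have hdiff : (∑ i ∈ Finset.range N, (h.1 (x + i) : ℝ)) / 2 ^ k -
      (∑ i ∈ Finset.range (2 ^ (k + 1)), (h.1 (x + i) : ℝ)) / 2 ^ (k + 1) =
      (∑ p ∈ s, d p) / (2 * N ^ 2) := by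
    rw [hD, pow_succ' (2 : ℕ), pow_succ' (2 : ℝ), hNR, ← hN, two_mul N,
      Finset.sum_range_add (fun i : ℕ => (h.1 (x + i) : ℝ))]
    field_simp
    ring
  have hcs := sq_sum_le_card_mul_sum_sq (s := s) (f := d)
  have hcard : ((s.card : ℕ) : ℝ) = N ^ 2 := by
    rw [hs, Finset.card_product, Finset.card_range]
    push_cast
    ring
  rw [hcard] at hcs
  have hsum := hJ.sum_energyTerm_le hα h s
    (f := fun p : ℕ × ℕ => (x + p.1, x + (N + p.2 : ℕ))) (by
      rintro ⟨i, j⟩ _ ⟨i', j'⟩ _ e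
      simp only [Prod.mk.injEq] at e ⊢
      omega)
  have hterm : ∀ p ∈ s, a * ((2 : ℝ) * N) ^ (-α) * d p ^ 2 ≤
      energyTerm J h.1 (x + p.1, x + (N + p.2 : ℕ)) := by
    rintro ⟨i, j⟩ hp
    simp only [hs, Finset.mem_product, Finset.mem_range] at hp
    obtain ⟨hi, hj⟩ := hp
    rw [energyTerm_of_ne (by push_cast; omega)]
    refine mul_le_mul_of_nonneg_right ?_ (sq_nonneg _)
    set r := (x + i - (x + (N + j : ℕ))).natAbs with hr
    have hr1 : 1 ≤ r := by omega
    have hr2 : r ≤ 2 * N := by omega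
    have hr1' : (0 : ℝ) < r := by exact_mod_cast hr1
    have hr2' : (r : ℝ) ≤ 2 * N := by exact_mod_cast hr2
    refine le_trans ?_ (hb r hr1)
    exact mul_le_mul_of_nonneg_left
      (Real.rpow_le_rpow_of_nonpos hr1' hr2' (by linarith)) ha.le
  have hfin := (Finset.sum_le_sum hterm).trans hsum
  rw [← Finset.mul_sum] at hfin
  rw [hdiff, div_pow, div_le_iff₀ (by positivity)]
  have h2N : (2 : ℝ) ^ (k + 1) = 2 * N := by rw [pow_succ', hNR]
  rw [h2N]
  have h2pos : (0 : ℝ) < 2 * N := by positivity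
  have hpow : ((2 : ℝ) * N) ^ (α - 2) * (2 * N ^ 2) ^ 2 = N ^ 2 * (2 * N) ^ α := by
    rw [Real.rpow_sub h2pos]
    norm_num
    field_simp
  have hinv : ((2 : ℝ) * N) ^ α * (2 * N) ^ (-α) = 1 := by
    rw [← Real.rpow_add h2pos]
    simp
  have hS : ∑ p ∈ s, d p ^ 2 ≤ energy J h.1 / a * (2 * N) ^ α := by
    rw [div_mul_eq_mul_div, le_div_iff₀ ha]
    calc _ = (2 * (N : ℝ)) ^ α * (a * (2 * (N : ℝ)) ^ (-α) * ∑ p ∈ s, d p ^ 2) := by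
          linear_combination -(a * ∑ p ∈ s, d p ^ 2) * hinv
      _ ≤ (2 * (N : ℝ)) ^ α * energy J h.1 :=
          mul_le_mul_of_nonneg_left hfin (Real.rpow_pos_of_pos h2pos _).le
      _ = _ := mul_comm _ _
  calc _ ≤ (N : ℝ) ^ 2 * (energy J h.1 / a * (2 * N) ^ α) :=
        hcs.trans (mul_le_mul_of_nonneg_left hS (by positivity))
    _ = _ := by linear_combination -(energy J h.1 / a) * hpow

/-- Transience: for `α < 2` the energy controls the height at every site, uniformly in the size of
the system. -/
theorem IsCoupling.exists_sq_le_energy {α : ℝ} {J : ℕ → ℝ} (hJ : IsCoupling α J) (hα : 1 < α)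
    (hα2 : α < 2) : ∃ C : ℝ, 0 < C ∧ ∀ (n : ℕ) (h : Config n) (x : ℤ),
      (h.1 x : ℝ) ^ 2 ≤ C * energy J h.1 := by
  obtain ⟨a, A, ha, hA, hb⟩ := id hJ
  -- The geometric ratio of successive dyadic increments; `q < 1` because `α < 2`.
  set q : ℝ := 2 ^ ((α - 2) / 2) with hq
  have hq0 : 0 < q := Real.rpow_pos_of_pos two_pos _
  have hq1 : q < 1 := Real.rpow_lt_one_of_one_lt_of_neg one_lt_two (by linarith)
  have hq1' : 0 < 1 - q := sub_pos.2 hq1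
  refine ⟨(q / (1 - q)) ^ 2 / a, by positivity, fun n h x => ?_⟩
  have hE := hJ.energy_nonneg h.1
  have hE' : 0 ≤ energy J h.1 / a := by positivity
  set f : ℕ → ℝ := fun k => (∑ i ∈ Finset.range (2 ^ k), (h.1 (x + i) : ℝ)) / 2 ^ k with hf
  have hstep : ∀ k, dist (f k) (f (k + 1)) ≤ (Real.sqrt (energy J h.1 / a) * q) * q ^ k := by
    intro k
    rw [Real.dist_eq, mul_assoc, ← pow_succ']
    refine abs_le_of_sq_le_sq ?_ (by positivity)
    refine (hJ.sq_dyadic_increment_le hα ha (fun r hr => (hb r hr).1) h x k).trans_eq ?_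
    rw [mul_pow, Real.sq_sqrt hE']
    congr 1
    rw [hq, ← Real.rpow_natCast (2 : ℝ), ← Real.rpow_mul two_pos.le, ← Real.rpow_natCast,
      ← Real.rpow_natCast, ← Real.rpow_mul two_pos.le, ← Real.rpow_mul two_pos.le]
    congr 1
    push_cast
    ring
  have h1 := dist_le_of_le_geometric_of_tendsto₀ q _ hq1 hstep (h.tendsto_dyadic_average x)
  have h2 : f 0 = h.1 x := by simp [hf]
  rw [h2, dist_zero_right, Real.norm_eq_abs] at h1
  calc (h.1 x : ℝ) ^ 2 = |(h.1 x : ℝ)| ^ 2 := (sq_abs _).symm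
    _ ≤ (Real.sqrt (energy J h.1 / a) * q / (1 - q)) ^ 2 := pow_le_pow_left₀ (abs_nonneg _) h1 2
    _ = _ := by
      rw [mul_div_assoc, mul_pow, Real.sq_sqrt hE']
      ring

end Transience

/-! ### Comparison with the nearest neighbour chain for `α > 3` -/

section NearestNeighbour

/-- The energy of the chain with nearest neighbour coupling. -/
noncomputable def gradientEnergy (h : ℤ → ℤ) : ℝ := ∑' k : ℤ, ((h (k + 1) : ℝ) - h k) ^ 2

theorem Config.gradient_eq_zero {n : ℕ} (h : Config n) {k : ℤ}
    (hk : k ∉ Finset.Ico (-((n : ℤ) + 1)) (n + 1)) : ((h.1 (k + 1) : ℝ) - h.1 k) ^ 2 = 0 := by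
  rw [Finset.mem_Ico] at hk
  rw [h.2 k (by simp only [Set.mem_Icc]; omega), h.2 (k + 1) (by simp only [Set.mem_Icc]; omega)]
  simp

theorem Config.gradientEnergy_eq_sum {n : ℕ} (h : Config n) : gradientEnergy h.1 =
    ∑ k ∈ Finset.Ico (-((n : ℤ) + 1)) (n + 1), ((h.1 (k + 1) : ℝ) - h.1 k) ^ 2 :=
  tsum_eq_sum fun _ hk => h.gradient_eq_zero hk

/-- Lagrange identity. It exhibits the Cauchy–Schwarz defect as a sum of squares of linear
functionals, which is what reinforcement requires; mere nonnegativity would not do. -/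
theorem sum_sum_sub_sq {ι : Type*} (s : Finset ι) (a : ι → ℝ) :
    ∑ k ∈ s, ∑ l ∈ s, (a k - a l) ^ 2 = 2 * (s.card * ∑ k ∈ s, a k ^ 2 - (∑ k ∈ s, a k) ^ 2) := by
  have e : ∀ k l, (a k - a l) ^ 2 = a k ^ 2 + a l ^ 2 - 2 * (a k * a l) := fun k l => by ring
  simp only [e, Finset.sum_sub_distrib, Finset.sum_add_distrib, Finset.sum_const, nsmul_eq_mul,
    ← Finset.mul_sum, ← Finset.sum_mul]
  ring

theorem sum_Ico_int_sub (f : ℤ → ℝ) {i j : ℤ} (hij : i ≤ j) :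
    ∑ k ∈ Finset.Ico i j, (f (k + 1) - f k) = f j - f i := by
  induction j, hij using Int.leInduction with
  | base => simp
  | succ j hij ih =>
    rw [← Finset.insert_Ico_right_eq_Ico_add_one hij, Finset.sum_insert (by simp), ih]
    ring

/-- Replacing one long range coupling by couplings along the path of nearest neighbours
reinforces the chain. -/
theorem reinforces_path (n : ℕ) {c : ℝ} (hc : 0 ≤ c) {i j : ℤ} (hij : i ≤ j) :
    Reinforces fun h : Config n => c * ((j - i) *
      (∑ k ∈ Finset.Ico i j, ((h.1 (k + 1) : ℝ) - h.1 k) ^ 2) - ((h.1 i : ℝ) - h.1 j) ^ 2) := by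
  have h := reinforces_sum (Finset.Ico i j) fun k _ => reinforces_sum (Finset.Ico i j) fun l _ =>
    reinforces_mul_sq (c := 1 / 2) (by norm_num)
      (AddMonoidHom.mulLeft (Real.sqrt c) |>.comp
        ((heightHom n (k + 1) - heightHom n k) - (heightHom n (l + 1) - heightHom n l)))
  convert h using 2 with x
  simp only [AddMonoidHom.comp_apply, AddMonoidHom.sub_apply, AddMonoidHom.coe_mulLeft,
    heightHom_apply, mul_pow, Real.sq_sqrt hc, ← Finset.mul_sum]
  rw [sum_sum_sub_sq (Finset.Ico i j) fun k => (x.1 (k + 1) : ℝ) - x.1 k,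
    sum_Ico_int_sub (fun k => (x.1 k : ℝ)) hij, Int.card_Ico]
  have : (((j - i).toNat : ℕ) : ℝ) = j - i := by
    rw [← Int.cast_natCast, Int.toNat_of_nonneg (by omega)]
    push_cast
    rfl
  rw [this]
  ring

/-- The weight with which the coupling between a pair of sites loads the edge `{k, k + 1}` when it
is replaced by nearest neighbour couplings. -/
noncomputable def edgeLoad (J : ℕ → ℝ) (k : ℤ) (p : ℤ × ℤ) : ℝ :=
  if min p.1 p.2 ≤ k ∧ k < max p.1 p.2 then
    J (p.1 - p.2).natAbs * ((p.1 - p.2).natAbs : ℝ) else 0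

/-- For each orientation, `r` pairs at distance `r` cross a given edge, each with load `r * J r`, so
the total is of order `∑ r ^ (2 - α)`. -/
theorem IsCoupling.summable_edgeLoad {α : ℝ} {J : ℕ → ℝ} (hJ : IsCoupling α J) (hα : 3 < α) :
    Summable (edgeLoad J 0) := by
  set w : ℤ × ℤ → ℝ := fun p => if p.1 ≤ 0 ∧ 0 < p.2 then
    J (p.1 - p.2).natAbs * ((p.1 - p.2).natAbs : ℝ) else 0 with hw
  have hws : Summable w := by
    have hinj : Function.Injective fun p : ℕ × ℕ => ((-(p.1 : ℤ), (p.2 : ℤ) + 1) : ℤ × ℤ) := by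
      rintro ⟨a, b⟩ ⟨c, d⟩ e
      simp only [Prod.mk.injEq] at e ⊢
      omega
    refine (hinj.summable_iff fun p hp => ?_).1 ?_
    · refine if_neg fun hp' => hp ⟨(p.1.natAbs, (p.2 - 1).natAbs), ?_⟩
      ext1
      · simp only
        omega
      · simp only
        omega
    · have hpos := fun r : ℕ => hJ.pos (r := r)
      obtain ⟨a, A, ha, hA, hb⟩ := hJ
      have hs1 : Summable fun u : ℕ => ((u : ℝ) + 1) ^ ((1 - α) / 2) := by
        have := (summable_nat_add_iff 1).2 (Real.summable_nat_rpow (p := (1 - α) / 2).2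
          (by linarith))
        simpa using this
      refine Summable.of_nonneg_of_le (fun p => ?_) (fun p => ?_)
        ((summable_mul_of_summable_norm hs1.norm hs1.norm).mul_left A)
      · simp only [Function.comp_apply, hw]
        split_ifs
        · exact mul_nonneg (hpos _ (by omega)).le (Nat.cast_nonneg _)
        · exact le_rfl
      · obtain ⟨u, v⟩ := p
        have e : (-(u : ℤ) - ((v : ℤ) + 1)).natAbs = u + v + 1 := by omega
        simp only [Function.comp_apply, hw, e]
        rw [if_pos (by omega)]
        have hr := (hb (u + v + 1) (by omega)).2
        have hrpos : (0 : ℝ) < ((u + v + 1 : ℕ) : ℝ) := by positivity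
        calc _ ≤ A * ((u + v + 1 : ℕ) : ℝ) ^ (-α) * ((u + v + 1 : ℕ) : ℝ) :=
              mul_le_mul_of_nonneg_right hr hrpos.le
          _ = A * (((u + v + 1 : ℕ) : ℝ) ^ 2) ^ ((1 - α) / 2) := by
              rw [mul_assoc, ← Real.rpow_natCast, ← Real.rpow_mul hrpos.le]
              nth_rewrite 2 [← Real.rpow_one ((u + v + 1 : ℕ) : ℝ)]
              rw [← Real.rpow_add hrpos]
              congr 2
              push_cast
              ring
          -- `(u + v + 1) ^ 2 ≥ (u + 1) * (v + 1)` separates the variables, and `(1 - α) / 2 < -1`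
          -- since `α > 3`.
          _ ≤ A * (((u : ℝ) + 1) * ((v : ℝ) + 1)) ^ ((1 - α) / 2) := by
              refine mul_le_mul_of_nonneg_left ?_ hA.le
              refine Real.rpow_le_rpow_of_nonpos (by positivity) ?_ (by linarith)
              push_cast
              have hu : (0 : ℝ) ≤ u := Nat.cast_nonneg u
              have hv : (0 : ℝ) ≤ v := Nat.cast_nonneg v
              nlinarith [mul_nonneg hu hv]
          _ = _ := by
              rw [Real.mul_rpow (by positivity) (by positivity)]
  refine (hws.add ((Equiv.prodComm ℤ ℤ).summable_iff.2 hws)).congr fun p => ?_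
  obtain ⟨i, j⟩ := p
  change w (i, j) + w (j, i) = edgeLoad J 0 (i, j)
  simp only [hw, edgeLoad]
  have e : (j - i).natAbs = (i - j).natAbs := by omega
  rw [e]
  by_cases h1 : i ≤ 0 ∧ 0 < j
  · rw [if_pos h1, if_neg (by omega), if_pos (by omega), add_zero]
  · by_cases h2 : j ≤ 0 ∧ 0 < i
    · rw [if_neg h1, if_pos h2, if_pos (by omega), zero_add]
    · rw [if_neg h1, if_neg h2, if_neg (by omega), zero_add]

theorem IsCoupling.hasSum_edgeLoad {α : ℝ} {J : ℕ → ℝ} (hJ : IsCoupling α J) (hα : 3 < α)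
    (k : ℤ) : HasSum (edgeLoad J k) (∑' p, edgeLoad J 0 p) := by
  have h := (hJ.summable_edgeLoad hα).hasSum
  rw [← ((Equiv.subRight k).prodCongr (Equiv.subRight k)).hasSum_iff] at h
  convert h using 1
  ext ⟨i, j⟩
  simp only [edgeLoad, Function.comp_apply, Equiv.prodCongr_apply, Prod.map_apply,
    Equiv.subRight_apply, sub_sub_sub_cancel_right]
  refine if_congr ?_ rfl rfl
  omega

theorem IsCoupling.tsum_edgeLoad_pos {α : ℝ} {J : ℕ → ℝ} (hJ : IsCoupling α J) (hα : 3 < α) :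
    0 < ∑' p, edgeLoad J 0 p := by
  refine (hJ.summable_edgeLoad hα).tsum_pos (fun p => ?_) (0, 1) ?_
  · rw [edgeLoad]
    split_ifs with h
    · exact mul_nonneg (hJ.pos (by omega)).le (Nat.cast_nonneg _)
    · exact le_rfl
  · simpa [edgeLoad] using hJ.pos le_rfl

/-- For `α > 3` the chain is reinforced by a multiple of the nearest neighbour energy. -/
theorem IsCoupling.reinforces_gradientEnergy {α : ℝ} {J : ℕ → ℝ} (hJ : IsCoupling α J)
    (hα : 3 < α) (n : ℕ) {β : ℝ} (hβ : 0 < β) :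
    Reinforces fun h : Config n =>
      β * ((∑' p, edgeLoad J 0 p) * gradientEnergy h.1 - energy J h.1) := by
  set κ := ∑' p, edgeLoad J 0 p with hκ
  set K := Finset.Ico (-((n : ℤ) + 1)) (n + 1) with hK
  -- Decomposition by pairs of sites: each pair contributes its own path defect. The finite set `K`
  -- holds every edge on which the gradient can be nonzero.
  refine reinforces_of_hasSum (R := fun (p : ℤ × ℤ) (h : Config n) =>
    β * (∑ k ∈ K, edgeLoad J k p * ((h.1 (k + 1) : ℝ) - h.1 k) ^ 2 - energyTerm J h.1 p))
    (fun p => ?_) (fun h => ?_)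
  · obtain ⟨i, j⟩ := p
    by_cases hij : i = j
    · subst hij
      simpa [energyTerm, edgeLoad, not_lt_of_ge] using reinforces_zero
    · have hJ0 : 0 ≤ β * J (i - j).natAbs := mul_nonneg hβ.le (hJ.pos (by omega)).le
      have hp := reinforces_path n hJ0 (min_le_max : min i j ≤ max i j)
      convert hp using 2 with h
      rw [energyTerm_of_ne hij]
      have e1 : ∑ k ∈ K, edgeLoad J k (i, j) * ((h.1 (k + 1) : ℝ) - h.1 k) ^ 2 =
          (J (i - j).natAbs * ((i - j).natAbs : ℝ)) *
            ∑ k ∈ Finset.Ico (min i j) (max i j), ((h.1 (k + 1) : ℝ) - h.1 k) ^ 2 := by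
        have e2 : ∑ k ∈ Finset.Ico (min i j) (max i j), ((h.1 (k + 1) : ℝ) - h.1 k) ^ 2 =
            ∑ k ∈ K, if k ∈ Finset.Ico (min i j) (max i j) then
              ((h.1 (k + 1) : ℝ) - h.1 k) ^ 2 else 0 := by
          rw [← Finset.sum_filter, Finset.filter_mem_eq_inter, Finset.inter_comm]
          refine (Finset.sum_subset Finset.inter_subset_left fun k hk hk' => ?_).symm
          exact h.gradient_eq_zero fun hkK => hk' (Finset.mem_inter.2 ⟨hk, hkK⟩)
        rw [e2, Finset.mul_sum]
        refine Finset.sum_congr rfl fun k _ => ?_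
        simp only [edgeLoad, Finset.mem_Ico]
        split_ifs <;> simp
      have e3 : (((max i j : ℤ) : ℝ) - ((min i j : ℤ) : ℝ)) = ((i - j).natAbs : ℝ) := by
        rw [Nat.cast_natAbs, ← Int.cast_sub, max_sub_min_eq_abs, abs_sub_comm]
      have e4 : ((h.1 (min i j) : ℝ) - h.1 (max i j)) ^ 2 = ((h.1 i : ℝ) - h.1 j) ^ 2 := by
        rcases le_total i j with hle | hle
        · rw [min_eq_left hle, max_eq_right hle]
        · rw [min_eq_right hle, max_eq_left hle]
          ring
      rw [e1, e3, e4]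
      ring
  · refine HasSum.mul_left _ (HasSum.sub ?_ (hJ.hasSum_energy (by linarith) h))
    rw [h.gradientEnergy_eq_sum, Finset.mul_sum]
    exact hasSum_sum fun k _ => (hJ.hasSum_edgeLoad hα k).mul_right _

end NearestNeighbour

/-! ### Symmetric configurations as walks with free steps -/

section SymmetricWalk

/-- The symmetric configuration whose steps to the right of the origin are `-ξ`. -/
def walkConfig (n : ℕ) (ξ : Fin (n + 1) → ℤ) : Config n :=
  ⟨fun i => ∑ j : Fin (n + 1), if i.natAbs ≤ j then ξ j else 0, fun i hi =>
    Finset.sum_eq_zero fun j _ => if_neg (by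
      rw [Set.mem_Icc] at hi
      omega)⟩

theorem walkConfig_apply {n : ℕ} (ξ : Fin (n + 1) → ℤ) (i : ℤ) :
    (walkConfig n ξ).1 i = ∑ j : Fin (n + 1), if i.natAbs ≤ j then ξ j else 0 := rfl

theorem walkConfig_neg {n : ℕ} (ξ : Fin (n + 1) → ℤ) (i : ℤ) :
    (walkConfig n ξ).1 (-i) = (walkConfig n ξ).1 i := by
  simp only [walkConfig_apply, Int.natAbs_neg]

theorem walkConfig_zero {n : ℕ} (ξ : Fin (n + 1) → ℤ) :
    (walkConfig n ξ).1 0 = ∑ j, ξ j := by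
  simp [walkConfig_apply]

theorem walkConfig_sub {n : ℕ} (ξ : Fin (n + 1) → ℤ) (k : Fin (n + 1)) :
    (walkConfig n ξ).1 (k : ℕ) - (walkConfig n ξ).1 ((k : ℕ) + 1) = ξ k := by
  rw [walkConfig_apply, walkConfig_apply, ← Finset.sum_sub_distrib, Finset.sum_eq_single k]
  · rw [if_pos (by omega), if_neg (by omega), sub_zero]
  · intro j _ hj
    have hj' : (j : ℕ) ≠ k := fun e => hj (Fin.ext e)
    by_cases hlt : (k : ℕ) < j
    · rw [if_pos (by omega), if_pos (by omega), sub_self]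
    · rw [if_neg (by omega), if_neg (by omega), sub_self]
  · simp

theorem walkConfig_injective (n : ℕ) : Function.Injective (walkConfig n) := fun ξ η h =>
  funext fun k => by rw [← walkConfig_sub ξ, ← walkConfig_sub η, h]

theorem sum_range_ite_sub (f : ℕ → ℤ) (m N : ℕ) :
    (∑ j ∈ Finset.range N, if m ≤ j then f j - f (j + 1) else 0) =
      if m ≤ N then f m - f N else 0 := by
  induction N with
  | zero =>
    split_ifs with h
    · obtain rfl : m = 0 := by omega
      simp
    · simp
  | succ N ih =>
    rw [Finset.sum_range_succ, ih]
    by_cases h1 : m ≤ N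
    · rw [if_pos h1, if_pos h1, if_pos (by omega)]
      ring
    · rw [if_neg h1, if_neg h1]
      split_ifs with h2
      · obtain rfl : m = N + 1 := by omega
        simp
      · simp

/-- The right half is recovered from its decrements because `h (n + 1) = 0`, and the left half by
symmetry. -/
theorem exists_walkConfig_eq {n : ℕ} (h : Config n)
    (hs : ∀ i ∈ Finset.range (n + 1), h.1 (i : ℕ) = h.1 (-(i : ℕ))) :
    ∃ ξ, walkConfig n ξ = h := by
  refine ⟨fun k => h.1 (k : ℕ) - h.1 ((k : ℕ) + 1), Subtype.ext (funext fun i => ?_)⟩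
  have h1 := Fin.sum_univ_eq_sum_range
    (fun j => if i.natAbs ≤ j then h.1 (j : ℕ) - h.1 ((j : ℕ) + 1) else 0) (n + 1)
  rw [walkConfig_apply, h1]
  have h2 := sum_range_ite_sub (fun j => h.1 j) i.natAbs (n + 1)
  push_cast at h2
  rw [h2]
  by_cases hi : i.natAbs ≤ n
  · rw [if_pos (by omega), h.2 ((n : ℤ) + 1) (by simp only [Set.mem_Icc]; omega), sub_zero]
    rcases Int.natAbs_eq i with e | e
    · rw [Int.abs_eq_natAbs, ← e]
    · rw [Int.abs_eq_natAbs, hs i.natAbs (Finset.mem_range.2 (by omega)), ← e]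
  · rw [h.2 i (by simp only [Set.mem_Icc]; omega)]
    split_ifs with h3
    · rw [Int.abs_eq_natAbs, h.2 _ (by simp only [Set.mem_Icc]; omega),
        h.2 _ (by simp only [Set.mem_Icc]; omega),
        sub_self]
    · rfl

theorem gradientEnergy_walkConfig {n : ℕ} (ξ : Fin (n + 1) → ℤ) :
    gradientEnergy (walkConfig n ξ).1 = 2 * ∑ j, (ξ j : ℝ) ^ 2 := by
  set h := walkConfig n ξ with hh
  have h0 : HasSum (fun k : ℕ => ((h.1 ((k : ℤ) + 1) : ℝ) - h.1 (k : ℤ)) ^ 2)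
      (∑ j, (ξ j : ℝ) ^ 2) := by
    have e : ∑ j, (ξ j : ℝ) ^ 2 =
        ∑ k ∈ Finset.range (n + 1), ((h.1 ((k : ℤ) + 1) : ℝ) - h.1 (k : ℤ)) ^ 2 := by
      rw [← Fin.sum_univ_eq_sum_range
        (fun k : ℕ => ((h.1 ((k : ℤ) + 1) : ℝ) - h.1 (k : ℤ)) ^ 2) (n + 1)]
      refine Finset.sum_congr rfl fun j _ => ?_
      rw [← walkConfig_sub ξ j, ← hh]
      push_cast
      ring
    rw [e]
    refine hasSum_sum_of_ne_finset_zero fun k hk => h.gradient_eq_zero ?_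
    simp only [Finset.mem_range, Finset.mem_Ico] at hk ⊢
    omega
  have h1 : HasSum (fun k : ℕ => ((h.1 (-((k : ℤ) + 1) + 1) : ℝ) - h.1 (-((k : ℤ) + 1))) ^ 2)
      (∑ j, (ξ j : ℝ) ^ 2) := by
    convert h0 using 2 with k
    have e : -((k : ℤ) + 1) + 1 = -(k : ℤ) := by ring
    rw [e, hh, walkConfig_neg, walkConfig_neg]
    ring
  rw [two_mul]
  exact (HasSum.of_nat_of_neg_add_one
    (f := fun k : ℤ => ((h.1 (k + 1) : ℝ) - h.1 k) ^ 2) h0 h1).tsum_eq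

end SymmetricWalk

/-! ### Linear lower bound on the second moment -/

section LowerBound

/-- Passing to nearest neighbour couplings and then conditioning on reflection symmetry only
decreases the second moment. The symmetry removes the bridge constraint of the two-sided chain and
leaves independent steps. -/
theorem IsCoupling.exists_le_tsum_sq {α : ℝ} {J : ℕ → ℝ} (hJ : IsCoupling α J)
    (hα : 3 < α) {β : ℝ} (hβ : 0 < β) : ∃ c : ℝ, 0 < c ∧ ∀ n : ℕ,
      c * (n + 1) * ∑' h : Config n, Real.exp (-(1 / 2) * (β * energy J h.1)) ≤
        ∑' h : Config n, Real.exp (-(1 / 2) * (β * energy J h.1)) * (h.1 0 : ℝ) ^ 2 := by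
  set κ := ∑' p, edgeLoad J 0 p with hκ
  have hκpos : 0 < κ := hJ.tsum_edgeLoad_pos hα
  have hc : 0 < β * κ := mul_pos hβ hκpos
  -- The law of one step: the factor `1 / 2` in the weight cancels since each step occurs in both
  -- halves.
  set g : ℤ → ℝ := fun k => Real.exp (-(β * κ) * (k : ℝ) ^ 2) with hg
  have hgs : Summable g := summable_exp_neg_mul_sq hc
  have hg2 : Summable fun k => g k * (k : ℝ) ^ 2 := summable_exp_neg_mul_sq_mul_sq hc
  set z := ∑' k, g k with hz
  set s := ∑' k, g k * (k : ℝ) ^ 2 with hs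
  have hzpos : 0 < z := hgs.tsum_pos (fun _ => (Real.exp_pos _).le) 0 (Real.exp_pos _)
  have hspos : 0 < s := hg2.tsum_pos (fun k => by positivity) 1 (by simp only [hg]; positivity)
  refine ⟨s / z, by positivity, fun n => ?_⟩
  have hQ := hJ.isGaussianForm (by linarith) n hβ
  obtain ⟨a, ha, hnn⟩ := hJ.exists_sq_le_nearest (by linarith)
  set S : Config n → ℝ := fun h =>
    ∑ i ∈ Finset.range (n + 1), ((h.1 (i : ℕ) : ℝ) - h.1 (-(i : ℕ))) ^ 2 with hS
  set T : Config n → ℝ := fun h => β * (κ * gradientEnergy h.1 - energy J h.1) with hT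
  have hS0 : ∀ h, 0 ≤ S h := fun h => Finset.sum_nonneg fun _ _ => sq_nonneg _
  have hR : ∀ k : ℕ, Reinforces fun h => T h + k * S h := fun k => by
    refine (hJ.reinforces_gradientEnergy hα n hβ).add ?_
    have := reinforces_sum (Finset.range (n + 1)) fun i _ => reinforces_mul_sq (Nat.cast_nonneg k)
      (heightHom n (i : ℕ) - heightHom n (-(i : ℕ)))
    simp only [← Finset.mul_sum] at this
    exact this
  classical
  -- The limit `k → ∞` of the penalty `k * S` restricts to symmetric configurations, while `T`
  -- replaces the energy by `κ * gradientEnergy`.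
  set ρ : Config n → ℝ := fun h => if S h = 0 then Real.exp (-(1 / 2) * T h) else 0 with hρ
  have hlim : ∀ h, Tendsto (fun k : ℕ => Real.exp (-(1 / 2) * (T h + k * S h))) atTop
      (𝓝 (ρ h)) := fun h => by
    simp only [hρ]
    split_ifs with h0
    · simp only [h0, mul_zero, add_zero]
      exact tendsto_const_nhds
    · have hpos : 0 < S h := lt_of_le_of_ne (hS0 h) (Ne.symm h0)
      refine Real.tendsto_exp_atBot.comp ?_
      refine Tendsto.const_mul_atTop_of_neg (by norm_num) ?_
      exact tendsto_atTop_add_const_left _ _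
        (Tendsto.atTop_mul_const hpos tendsto_natCast_atTop_atTop)
  have key := tsum_sq_le_of_tendsto hQ (heightHom n 0) (C := (2 * n + 1) / a / β) (fun h => by
    rw [heightHom_apply]
    refine (hnn n h 0).trans_eq ?_
    field_simp) hR hlim
  have hsupp : ∀ f : Config n → ℝ, Function.support (fun h => ρ h * f h) ⊆
      Set.range (walkConfig n) := fun f h hh => by
    refine exists_walkConfig_eq h fun i hi => ?_
    have hS1 : S h = 0 := by
      by_contra hne
      exact hh (by simp [hρ, hne])
    have := (Finset.sum_eq_zero_iff_of_nonneg fun _ _ => sq_nonneg _).1 hS1 i hi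
    have h3 := sub_eq_zero.1 (pow_eq_zero_iff two_ne_zero |>.1 this)
    exact_mod_cast h3
  have hval : ∀ ξ, ρ (walkConfig n ξ) * Real.exp (-(1 / 2) * (β * energy J (walkConfig n ξ).1)) =
      ∏ j, g (ξ j) := fun ξ => by
    have hS1 : S (walkConfig n ξ) = 0 := by simp [hS, walkConfig_neg]
    simp only [hρ]
    rw [if_pos hS1, ← Real.exp_add, hg, ← Real.exp_sum, ← Finset.mul_sum]
    congr 1
    simp only [hT]
    rw [gradientEnergy_walkConfig]
    ring
  obtain ⟨w0, -, w2⟩ := hasSum_walk (g := g) (fun _ => (Real.exp_pos _).le)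
    (fun k => by simp [hg]) hgs hg2 hzpos.ne' (n + 1)
  rw [← (walkConfig_injective n).tsum_eq (hsupp _), ← (walkConfig_injective n).tsum_eq (hsupp _)]
    at key
  have e2 : ∀ ξ, ρ (walkConfig n ξ) * (Real.exp (-(1 / 2) * (β * energy J (walkConfig n ξ).1)) *
      heightHom n 0 (walkConfig n ξ) ^ 2) = (∏ j, g (ξ j)) * (∑ j, (ξ j : ℝ)) ^ 2 := fun ξ => by
    rw [← mul_assoc, hval, heightHom_apply, walkConfig_zero]
    push_cast
    rfl
  rw [tsum_congr e2, tsum_congr hval, w0.tsum_eq, w2.tsum_eq] at key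
  rw [← hz, ← hs] at key
  have hzn : 0 < z ^ (n + 1) := by positivity
  refine le_of_mul_le_mul_right ?_ hzn
  simp only [heightHom_apply] at key
  calc _ = _ := by push_cast; ring
    _ ≤ _ := key

end LowerBound

/-! ### From Gibbs sums to the probability law -/

section Law

theorem gibbsWeight_univ {n : ℕ} {J : ℕ → ℝ} {β : ℝ}
    (hs : Summable fun h : Config n => Real.exp (-(β / 2) * energy J h.1)) :
    gibbsWeight n J β Set.univ =
      ENNReal.ofReal (∑' h : Config n, Real.exp (-(β / 2) * energy J h.1)) := by
  rw [gibbsWeight, Measure.sum_apply _ MeasurableSet.univ,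
    ENNReal.ofReal_tsum_of_nonneg (fun _ => (Real.exp_pos _).le) hs]
  simp

theorem isProbabilityMeasure_law {n : ℕ} {J : ℕ → ℝ} {β : ℝ}
    (hs : Summable fun h : Config n => Real.exp (-(β / 2) * energy J h.1)) :
    IsProbabilityMeasure (law n J β) := by
  constructor
  have hpos := hs.tsum_pos (fun _ => (Real.exp_pos _).le) 0 (Real.exp_pos _)
  rw [law, Measure.smul_apply, smul_eq_mul, gibbsWeight_univ hs]
  exact ENNReal.inv_mul_cancel (by simpa using hpos) ENNReal.ofReal_ne_top

theorem integrable_gibbsWeight {n : ℕ} {J : ℕ → ℝ} {β : ℝ} {f : (ℤ → ℤ) → ℝ}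
    (hf : Summable fun h : Config n => Real.exp (-(β / 2) * energy J h.1) * f h.1) :
    Integrable f (gibbsWeight n J β) := by
  rw [gibbsWeight, integrable_sum_dirac_iff (by simp)]
  refine hf.norm.congr fun h => ?_
  rw [norm_mul, ENNReal.toReal_ofReal (Real.exp_pos _).le, Real.norm_eq_abs (Real.exp _),
    Real.abs_exp]

theorem integrable_law {n : ℕ} {J : ℕ → ℝ} {β : ℝ} {f : (ℤ → ℤ) → ℝ}
    (hs : Summable fun h : Config n => Real.exp (-(β / 2) * energy J h.1))
    (hf : Summable fun h : Config n => Real.exp (-(β / 2) * energy J h.1) * f h.1) :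
    Integrable f (law n J β) := by
  have hpos := hs.tsum_pos (fun _ => (Real.exp_pos _).le) 0 (Real.exp_pos _)
  refine (integrable_gibbsWeight hf).smul_measure (ENNReal.inv_ne_top.2 ?_)
  rw [gibbsWeight_univ hs]
  simpa using hpos

theorem integral_law {n : ℕ} {J : ℕ → ℝ} {β : ℝ} {f : (ℤ → ℤ) → ℝ}
    (hs : Summable fun h : Config n => Real.exp (-(β / 2) * energy J h.1))
    (hf : Summable fun h : Config n => Real.exp (-(β / 2) * energy J h.1) * f h.1) :
    ∫ h, f h ∂(law n J β) = (∑' h : Config n, Real.exp (-(β / 2) * energy J h.1) * f h.1) /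
      ∑' h : Config n, Real.exp (-(β / 2) * energy J h.1) := by
  have hpos := hs.tsum_pos (fun _ => (Real.exp_pos _).le) 0 (Real.exp_pos _)
  have hint := integrable_gibbsWeight hf
  rw [law, integral_smul_measure, gibbsWeight_univ hs, ENNReal.toReal_inv,
    ENNReal.toReal_ofReal hpos.le, smul_eq_mul, inv_mul_eq_div]
  congr 1
  rw [gibbsWeight] at hint ⊢
  rw [integral_sum_measure hint]
  refine tsum_congr fun h => ?_
  rw [integral_smul_measure, integral_dirac, ENNReal.toReal_ofReal (Real.exp_pos _).le, smul_eq_mul]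

theorem measurable_height (x : ℤ) : Measurable (height x) :=
  (measurable_of_countable (fun k : ℤ => (k : ℝ))).comp (measurable_pi_apply x)

theorem Config.energy_neg {n : ℕ} (J : ℕ → ℝ) (h : Config n) :
    energy J (-h).1 = energy J h.1 := by
  refine tsum_congr fun p => ?_
  simp only [Config.coe_neg]
  refine if_congr Iff.rfl ?_ rfl
  push_cast
  ring

/-- The symmetry `h ↦ -h` preserves the weights; hence variances are plain second moments. -/
theorem tsum_exp_mul_height (n : ℕ) (J : ℕ → ℝ) (β : ℝ) (x : ℤ) :
    ∑' h : Config n, Real.exp (-(β / 2) * energy J h.1) * (h.1 x : ℝ) = 0 := by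
  have h1 := (Equiv.neg (Config n)).tsum_eq
    fun h : Config n => Real.exp (-(β / 2) * energy J h.1) * (h.1 x : ℝ)
  have h2 : ∀ h : Config n, Real.exp (-(β / 2) * energy J (-h).1) * ((-h).1 x : ℝ) =
      -(Real.exp (-(β / 2) * energy J h.1) * (h.1 x : ℝ)) := fun h => by
    rw [Config.energy_neg, Config.coe_neg]
    push_cast
    ring
  simp only [Equiv.neg_apply, h2, tsum_neg] at h1
  linarith

/-- The law is a probability measure with square integrable heights, whose variances are the second
moments of the Gibbs weights. -/
theorem IsCoupling.law_height {α : ℝ} {J : ℕ → ℝ} (hJ : IsCoupling α J) (hα : 1 < α)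
    {β : ℝ} (hβ : 0 < β) (n : ℕ) (x : ℤ) :
    MemLp (height x) 2 (law n J β) ∧ variance (height x) (law n J β) =
      (∑' h : Config n, Real.exp (-(1 / 2) * (β * energy J h.1)) * (h.1 x : ℝ) ^ 2) /
        ∑' h : Config n, Real.exp (-(1 / 2) * (β * energy J h.1)) := by
  have hQ := hJ.isGaussianForm hα n hβ
  obtain ⟨a, ha, hnn⟩ := hJ.exists_sq_le_nearest hα
  have hX : ∀ h : Config n, heightHom n x h ^ 2 ≤ (2 * n + 1) / a / β * (β * energy J h.1) :=
    fun h => by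
      rw [heightHom_apply]
      refine (hnn n h x).trans_eq ?_
      field_simp
  have e : ∀ h : Config n, -(1 / 2) * (β * energy J h.1) = -(β / 2) * energy J h.1 :=
    fun h => by ring
  have s0 := hQ.summable (1 / 2) (by norm_num)
  have s1 := hQ.summable_exp_mul hX (t := 1 / 2) (by norm_num)
  have s2 := hQ.summable_exp_mul_sq hX (t := 1 / 2) (by norm_num)
  simp only [e, heightHom_apply] at s0 s1 s2 ⊢
  have := isProbabilityMeasure_law s0
  have hmem : MemLp (height x) 2 (law n J β) :=
    (memLp_two_iff_integrable_sq (measurable_height x).aestronglyMeasurable).2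
      (integrable_law s0 s2)
  refine ⟨hmem, ?_⟩
  have i1 : ∫ h, height x h ∂(law n J β) = 0 := by
    rw [integral_law s0 (f := height x) s1]
    simp only [height]
    rw [tsum_exp_mul_height, zero_div]
  have i2 := integral_law s0 (f := fun h => height x h ^ 2) s2
  rw [variance_eq_sub hmem, i1]
  simp only [Pi.pow_apply]
  rw [i2]
  simp only [height, ne_eq, OfNat.ofNat_ne_zero, not_false_eq_true, zero_pow, sub_zero]

theorem IsCoupling.variance_le {α : ℝ} {J : ℕ → ℝ} (hJ : IsCoupling α J) (hα : 1 < α)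
    {β : ℝ} (hβ : 0 < β) (n : ℕ) (x : ℤ) {C : ℝ} (hC : 0 < C)
    (h : ∀ h : Config n, (h.1 x : ℝ) ^ 2 ≤ C * energy J h.1) :
    variance (height x) (law n J β) ≤ 12 * C / β := by
  have hQ := hJ.isGaussianForm hα n hβ
  rw [(hJ.law_height hα hβ n x).2, div_le_iff₀ hQ.tsum_pos]
  refine (hQ.tsum_sq_le (heightHom n x) (C := C / β) (by positivity) fun k => ?_).trans_eq ?_
  · rw [heightHom_apply]
    refine (h k).trans_eq ?_
    field_simp
  · ring

theorem IsCoupling.isProbabilityMeasure_law {α : ℝ} {J : ℕ → ℝ} (hJ : IsCoupling α J)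
    (hα : 1 < α) {β : ℝ} (hβ : 0 < β) (n : ℕ) : IsProbabilityMeasure (law n J β) :=
  DGChain.isProbabilityMeasure_law (((hJ.isGaussianForm hα n hβ).summable (1 / 2)
    (by norm_num)).congr fun h => by ring_nf)

end Law

end DGChain

theorem proposition1p3 (α : ℝ) (J : ℕ → ℝ) (hJ : DGChain.IsCoupling α J) :
    (1 < α → α < 2 →
      ∃ c : ℝ, 0 < c ∧ ∀ β : ℝ, 0 < β → ∀ n : ℕ, 1 ≤ n →
        IsProbabilityMeasure (DGChain.law n J β) ∧
        ∀ x : ℤ, MemLp (DGChain.height x) 2 (DGChain.law n J β) ∧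
          variance (DGChain.height x) (DGChain.law n J β) ≤ c / β) ∧
    (3 < α →
      ∀ β : ℝ, 0 < β → ∃ c₁ c₂ : ℝ, 0 < c₁ ∧ c₁ < c₂ ∧ ∀ n : ℕ, 1 ≤ n →
        IsProbabilityMeasure (DGChain.law n J β) ∧
        MemLp (DGChain.height 0) 2 (DGChain.law n J β) ∧
        c₁ * (n : ℝ) ≤ variance (DGChain.height 0) (DGChain.law n J β) ∧
        variance (DGChain.height 0) (DGChain.law n J β) ≤ c₂ * (n : ℝ)) := by
  refine ⟨fun h1 h2 => ?_, fun h3 β hβ => ?_⟩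
  · obtain ⟨C, hC, hle⟩ := hJ.exists_sq_le_energy h1 h2
    exact ⟨12 * C, by positivity, fun β hβ n _ => ⟨hJ.isProbabilityMeasure_law h1 hβ n, fun x =>
      ⟨(hJ.law_height h1 hβ n x).1, hJ.variance_le h1 hβ n x hC fun h => hle n h x⟩⟩⟩
  · have h1 : 1 < α := by linarith
    obtain ⟨c, hc, hlow⟩ := hJ.exists_le_tsum_sq h3 hβ
    obtain ⟨a, ha, hup⟩ := hJ.exists_sq_le_nearest h1
    have hpos : 0 < 36 / (a * β) := by positivity
    -- `36 = 12 * 3`, from the moment constant and `2 * n + 1 ≤ 3 * n`; adding `c` makes the two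
    -- constants strictly ordered.
    refine ⟨c, c + 36 / (a * β), hc, by linarith, fun n hn =>
      ⟨hJ.isProbabilityMeasure_law h1 hβ n, (hJ.law_height h1 hβ n 0).1, ?_, ?_⟩⟩
    · rw [(hJ.law_height h1 hβ n 0).2, le_div_iff₀ (hJ.isGaussianForm h1 n hβ).tsum_pos]
      refine le_trans ?_ (hlow n)
      exact mul_le_mul_of_nonneg_right (by nlinarith) (hJ.isGaussianForm h1 n hβ).tsum_pos.le
    · have hn' : (1 : ℝ) ≤ n := by exact_mod_cast hn
      have h := hJ.variance_le h1 hβ n 0 (C := (2 * n + 1) / a) (by positivity)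
        fun h => hup n h 0
      refine h.trans ?_
      calc 12 * ((2 * (n : ℝ) + 1) / a) / β = 12 / (a * β) * (2 * n + 1) := by field_simp
        _ ≤ 12 / (a * β) * (3 * n) := by gcongr; linarith
        _ = 36 / (a * β) * n := by ring
        _ ≤ (c + 36 / (a * β)) * n := by nlinarith
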